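/- **Setting.** Let $\mathcal R$ be a commutative semiring (e.g. a polynomial ring over $\mathbb N$ or $\mathbb Z$; the indeterminates are elements of $\mathcal R$). Let $\tau$ be a finite relational vocabulary for graphs (e.g. one binary relation symbol $R$, the adjacency relation on $A=V$ or the vertex–edge incidence relation on $A=V\cup E$), and let $\mathcal G$ be a class of finite $\tau$-structures, called graphs. Fix $m\in\mathbb N$. Structures $\bar G=\langle G,\vec x,O\rangle$ consist of a graph $G$ with universe $A$, a context $\vec x\in A^m$ and a relation $O\subseteq A^{2m}$. SOL denotes second order logic over $\tau\cup\{a_1,\dots,a_m,O\}$, with individual variables $v_i$ and relation variables $U_{r,i}$ of arity $r\ge 1$. *SOL-monomial expressions* are: elements of $\mathcal R$; truth values $\mathrm{tv}(\varphi)$ of SOL-formulas; finite products of monomial expressions; and $\prod_{\bar a:\phi}t$ with $\bar a$ a finite sequence of individual variables, $\phi$ an SOL-formula and $t$ a monomial expression. *SOL-polynomial expressions* are: monomial expressions; finite sums of polynomial expressions; short sums $\sum_{\bar a:\phi}t$ over individual variables; and long sums $\sum_{\bar W:\phi}t$ over relation variables. An expression is *short* if it contains no long sum. For an assignment $z$ of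 the individual and relation variables in $\bar G$, $e(S,\bar G,z)\in\mathcal R$ is the value of $S$, where $\prod_{\bar a:\phi}$, $\sum_{\bar a:\phi}$, $\sum_{\bar W:\phi}$ range over the assignments that differ from $z$ at most on the bound variables and satisfy $\phi$. A *recursive definition* $(\mathcal T,\mathrm{rec},\varphi_{ord})$ consists of an SOL-sentence $\varphi_{ord}$, finitely many pairs $(T_i,\varphi_i)$, $i\le\ell$, and coefficients $\sigma_i$, as follows. * An *ordered graph* $\bar G\models\varphi_{ord}$ is a structure $\bar G=\langle G,\vec x,O\rangle$ with $G\in\mathcal G$ that satisfies $\varphi_{ord}$ and in which $O$ is a strict linear ordering of $A^m$ with first element $\vec x$. The class of these is $\mathrm{VALORD}$. * $T_i$ consists of SOL-formulas $\phi(v)$, $\psi_r(\bar v)$ for each relation symbol $r$ of $\tau$, and $\psi_O(\bar v)$ with $2m$ free variables (no other free variables). $T_i^\star[\bar G]$ is the structure with universe $A'=\{a\in A:\bar G\models\phi(a)\}$, with the relations defined on $A'$ by the $\psi_r$ and $\psi_O$, and with context the first $m$-tuple in its ordering; if $A'=\emptyset$ it is the empty graph. * $\varphi_i$ (the guard) is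 an SOL-sentence, and $\sigma_i$ is a short SOL-polynomial expression without free variables; $\sigma_i(\bar G)$ denotes its value in $\bar G$. * For all $\bar G\in\mathrm{VALORD}$ with $\bar G\models\varphi_i$: $A'\subsetneq A$, some component of $\vec x$ is not in $A'$, the ordering of $T_i^\star[\bar G]$ is the restriction of $O$ to $A'$, and $T_i^\star[\bar G]$ is in $\mathrm{VALORD}$ or is the empty graph. A *deconstruction tree* $\Gamma(\bar G)$ is a finite tree with root marked by $\bar G$. Each leaf is marked by the empty graph. Each internal node $n$ is marked by a nonempty $\bar G_n$ with $\bar G_n\models\varphi_i$ for at least one $i$, and has, for exactly those $i$ with $\bar G_n\models\varphi_i$, an $i$-th child, marked by $T_i^\star[\bar G_n]$. Its *valuation* $P(\Gamma)\in\mathcal R$ is $1$ at a leaf, and $$P(\Gamma(\bar G_n))=\sum_{i:\ \bar G_n\models\varphi_i}\sigma_i(\bar G_n)\cdot P(\Gamma(T_i^\star[\bar G_n]))$$ at an internal node. The recursive definition is *SOL-feasible* if (a) every nonempty graph $G\in\mathcal G$ has an expansion $\langle G,\vec x,O\rangle\in\mathrm{VALORD}$; (b) every $\bar G\in\mathrm{VALORD}$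 has a deconstruction tree; (c) $P(\Gamma(\bar G_1))=P(\Gamma(\bar G_2))$ whenever $\bar G_1,\bar G_2\in\mathrm{VALORD}$ are expansions of the same graph. **Theorem.** Let $(\mathcal T,\mathrm{rec},\varphi_{ord})$ be an SOL-feasible recursive definition. Then there is an SOL-polynomial expression $S$ such that for every ordered graph $\bar G\models\varphi_{ord}$ and every assignment $z$ in $\bar G$, $$P(\Gamma(\bar G))=e(S,\bar G,z).$$ -/

import Mathlib

namespace SOL

/-! ## Second order logic over ordered graphs with a context -/

/-- A finite relational vocabulary `τ` for graphs. The vocabularies of graphs as vertex sets with an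
edge relation, and of graphs as sets of vertices and edges with an incidence relation, both consist
of one binary relation symbol. -/
structure Vocabulary where
  numRel : ℕ
  arity : Fin numRel → ℕ

/-- Relation variables `U_{r,i}` of arity `r ≥ 1`. The individual variables `v_i` are given by their
index `i : ℕ`. -/
structure RelVar where
  arity : ℕ
  idx : ℕ
  pos : 1 ≤ arity
deriving DecidableEq

/-- Terms over the vocabulary `τ ∪ {a_1, …, a_m, O}`: variables and context constants. -/
inductive Term (m : ℕ) : Type
  | var (i : ℕ) : Term m
  | con (j : Fin m) : Term m

/-- Formulas of second order logic over `τ ∪ {a_1, …, a_m, O}`, where `O` is `2m`-ary and is written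
as a binary relation between `m`-tuples. -/
inductive Formula (τ : Vocabulary) (m : ℕ) : Type
  | eq (s t : Term m) : Formula τ m
  | rel (r : Fin τ.numRel) (t : Fin (τ.arity r) → Term m) : Formula τ m
  | ord (s t : Fin m → Term m) : Formula τ m
  | relVar (U : RelVar) (t : Fin U.arity → Term m) : Formula τ m
  | or (φ ψ : Formula τ m) : Formula τ m
  | and (φ ψ : Formula τ m) : Formula τ m
  | imp (φ ψ : Formula τ m) : Formula τ m
  | not (φ : Formula τ m) : Formula τ m
  | exInd (i : ℕ) (φ : Formula τ m) : Formula τ m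
  | allInd (i : ℕ) (φ : Formula τ m) : Formula τ m
  | exRel (U : RelVar) (φ : Formula τ m) : Formula τ m
  | allRel (U : RelVar) (φ : Formula τ m) : Formula τ m

/-- Individual and relation variables together. -/
abbrev Var : Type := ℕ ⊕ RelVar

def Term.free {m : ℕ} : Term m → Set Var
  | .var i => {Sum.inl i}
  | .con _ => ∅

def Formula.free {τ : Vocabulary} {m : ℕ} : Formula τ m → Set Var
  | .eq s t => s.free ∪ t.free
  | .rel _ t => ⋃ j, (t j).free
  | .ord s t => (⋃ j, (s j).free) ∪ ⋃ j, (t j).free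
  | .relVar U t => {Sum.inr U} ∪ ⋃ j, (t j).free
  | .or φ ψ => φ.free ∪ ψ.free
  | .and φ ψ => φ.free ∪ ψ.free
  | .imp φ ψ => φ.free ∪ ψ.free
  | .not φ => φ.free
  | .exInd i φ => φ.free \ {Sum.inl i}
  | .allInd i φ => φ.free \ {Sum.inl i}
  | .exRel U φ => φ.free \ {Sum.inr U}
  | .allRel U φ => φ.free \ {Sum.inr U}

/-- The free variables of `φ` are among the individual variables `v_0, …, v_{n-1}`. -/
def Formula.FreeBelow {τ : Vocabulary} {m : ℕ} (n : ℕ) (φ : Formula τ m) : Prop :=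
  φ.free ⊆ Sum.inl '' {i : ℕ | i < n}

/-- A formula without free variables. -/
def Formula.IsSentence {τ : Vocabulary} {m : ℕ} (φ : Formula τ m) : Prop := φ.free = ∅

/-- A finite `τ`-structure ("graph"): its universe is a finite set of elements of `V`. The universe
may be all of `V`, and it may be empty (the empty graph). -/
@[ext]
structure Graph (τ : Vocabulary) (V : Type) where
  univ : Finset V
  rel : (r : Fin τ.numRel) → (Fin (τ.arity r) → V) → Prop
  rel_mem : ∀ r t, rel r t → ∀ j, t j ∈ univ

/-- `⟨G, x, O⟩`: a graph with interpretations of the context constants and of `O`. No relation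
between them is imposed here. -/
structure OrdGraph (τ : Vocabulary) (m : ℕ) (V : Type) extends Graph τ V where
  ctx : Fin m → V
  ord : (Fin m → V) → (Fin m → V) → Prop

/-- An interpretation of all individual and relation variables in `V`. -/
structure Assign (V : Type) where
  ind : ℕ → V
  rel : (U : RelVar) → Finset (Fin U.arity → V)

/-- `r`-ary tuples of elements of the universe. -/
def Graph.tuples {τ : Vocabulary} {V : Type} (G : Graph τ V) (r : ℕ) : Finset (Fin r → V) :=
  Fintype.piFinset fun _ => G.univ

/-- The assignments in `G`: `z(v_i) ∈ A` and `z(U_{r,i}) ⊆ A^r`. -/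
def Graph.Ass {τ : Vocabulary} {V : Type} (G : Graph τ V) : Set (Assign V) :=
  {z | (∀ i, z.ind i ∈ G.univ) ∧ ∀ U, z.rel U ⊆ G.tuples U.arity}

def Assign.setInd {V : Type} (z : Assign V) (i : ℕ) (a : V) : Assign V :=
  { z with ind := Function.update z.ind i a }

def Assign.setRel {V : Type} (z : Assign V) (U : RelVar) (W : Finset (Fin U.arity → V)) :
    Assign V :=
  { z with rel := Function.update z.rel U W }

def Term.eval {τ : Vocabulary} {m : ℕ} {V : Type} (M : OrdGraph τ m V) (z : Assign V) :
    Term m → V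
  | .var i => z.ind i
  | .con j => M.ctx j

/-- `M, z ⊨ φ`. -/
def Formula.Sat {τ : Vocabulary} {m : ℕ} {V : Type} (M : OrdGraph τ m V) :
    Formula τ m → Assign V → Prop
  | .eq s t, z => s.eval M z = t.eval M z
  | .rel r t, z => M.rel r fun j => (t j).eval M z
  | .ord s t, z => M.ord (fun j => (s j).eval M z) (fun j => (t j).eval M z)
  | .relVar U t, z => (fun j => (t j).eval M z) ∈ z.rel U
  | .or φ ψ, z => φ.Sat M z ∨ ψ.Sat M z
  | .and φ ψ, z => φ.Sat M z ∧ ψ.Sat M z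
  | .imp φ ψ, z => φ.Sat M z → ψ.Sat M z
  | .not φ, z => ¬ φ.Sat M z
  | .exInd i φ, z => ∃ a ∈ M.univ, φ.Sat M (z.setInd i a)
  | .allInd i φ, z => ∀ a ∈ M.univ, φ.Sat M (z.setInd i a)
  | .exRel U φ, z => ∃ W ⊆ M.tuples U.arity, φ.Sat M (z.setRel U W)
  | .allRel U φ, z => ∀ W ⊆ M.tuples U.arity, φ.Sat M (z.setRel U W)

/-- `M ⊨ φ(b_0, …, b_{n-1})` for a formula whose free variables are among `v_0, …, v_{n-1}`. -/
def OrdGraph.Holds {τ : Vocabulary} {m : ℕ} {V : Type} (M : OrdGraph τ m V) {n : ℕ}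
    (φ : Formula τ m) (b : Fin n → V) : Prop :=
  ∀ z ∈ M.Ass, (∀ j : Fin n, z.ind j = b j) → φ.Sat M z

/-- `M ⊨ φ` for a sentence `φ`. -/
def OrdGraph.Models {τ : Vocabulary} {m : ℕ} {V : Type} (M : OrdGraph τ m V)
    (φ : Formula τ m) : Prop :=
  ∀ z ∈ M.Ass, φ.Sat M z

/-! ## SOL-polynomial expressions -/

/-- SOL-monomial expressions. In `bprod`, the finite set of individual variables is bound. The
indeterminates are elements of the semiring `R`. -/
inductive MonoExpr (τ : Vocabulary) (m : ℕ) (R : Type*) : Type _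
  | const (a : R) : MonoExpr τ m R
  | tv (φ : Formula τ m) : MonoExpr τ m R
  | prod (n : ℕ) (t : Fin n → MonoExpr τ m R) : MonoExpr τ m R
  | bprod (a : Finset ℕ) (φ : Formula τ m) (t : MonoExpr τ m R) : MonoExpr τ m R

/-- SOL-polynomial expressions. `bsum` is the short sum over individual variables, `lsum` the long
sum over relation variables. -/
inductive PolyExpr (τ : Vocabulary) (m : ℕ) (R : Type*) : Type _
  | mono (t : MonoExpr τ m R) : PolyExpr τ m R
  | sum (n : ℕ) (t : Fin n → PolyExpr τ m R) : PolyExpr τ m R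
  | bsum (a : Finset ℕ) (φ : Formula τ m) (t : PolyExpr τ m R) : PolyExpr τ m R
  | lsum (W : Finset RelVar) (φ : Formula τ m) (t : PolyExpr τ m R) : PolyExpr τ m R

def MonoExpr.free {τ : Vocabulary} {m : ℕ} {R : Type*} : MonoExpr τ m R → Set Var
  | .const _ => ∅
  | .tv φ => φ.free
  | .prod _ t => ⋃ j, (t j).free
  | .bprod a φ t => (t.free ∪ φ.free) \ (Sum.inl '' (a : Set ℕ))

def PolyExpr.free {τ : Vocabulary} {m : ℕ} {R : Type*} : PolyExpr τ m R → Set Var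
  | .mono t => t.free
  | .sum _ t => ⋃ j, (t j).free
  | .bsum a φ t => (t.free ∪ φ.free) \ (Sum.inl '' (a : Set ℕ))
  | .lsum W φ t => (t.free ∪ φ.free) \ (Sum.inr '' (W : Set RelVar))

/-- An expression is short if it contains no long sums. -/
def PolyExpr.IsShort {τ : Vocabulary} {m : ℕ} {R : Type*} : PolyExpr τ m R → Prop
  | .mono _ => True
  | .sum _ t => ∀ j, (t j).IsShort
  | .bsum _ _ t => t.IsShort
  | .lsum _ _ _ => False

/-- The assignment that agrees with `f` on the individual variables in `a` and with `z` on all other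
variables. -/
def Assign.overInd {V : Type} (z : Assign V) (a : Finset ℕ) (f : a → V) : Assign V :=
  { z with ind := fun i => if h : i ∈ a then f ⟨i, h⟩ else z.ind i }

/-- The assignment that agrees with `f` on the relation variables in `W` and with `z` on all other
variables. -/
def Assign.overRel {V : Type} (z : Assign V) (W : Finset RelVar)
    (f : (U : W) → Finset (Fin U.1.arity → V)) : Assign V :=
  { z with rel := fun U => if h : U ∈ W then f ⟨U, h⟩ else z.rel U }

open Classical in
/-- The interpretation `e(S, M, z)` of a monomial expression. The bound product ranges over the
assignments in `M` that differ from `z` at most on the bound variables and that satisfy `φ`. -/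
noncomputable def MonoExpr.eval {τ : Vocabulary} {m : ℕ} {R : Type*} [CommSemiring R] {V : Type}
    (M : OrdGraph τ m V) : MonoExpr τ m R → Assign V → R
  | .const a, _ => a
  | .tv φ, z => if φ.Sat M z then 1 else 0
  | .prod _ t, z => ∏ j, (t j).eval M z
  | .bprod a φ t, z =>
      ∏ f ∈ (Fintype.piFinset fun _ : a => M.univ) with φ.Sat M (z.overInd a f),
        t.eval M (z.overInd a f)

open Classical in
/-- The interpretation `e(S, M, z)` of a polynomial expression. The bound sums range over the
assignments in `M` that differ from `z` at most on the bound variables and that satisfy `φ`. -/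
noncomputable def PolyExpr.eval {τ : Vocabulary} {m : ℕ} {R : Type*} [CommSemiring R] {V : Type}
    (M : OrdGraph τ m V) : PolyExpr τ m R → Assign V → R
  | .mono t, z => t.eval M z
  | .sum _ t, z => ∑ j, (t j).eval M z
  | .bsum a φ t, z =>
      ∑ f ∈ (Fintype.piFinset fun _ : a => M.univ) with φ.Sat M (z.overInd a f),
        t.eval M (z.overInd a f)
  | .lsum W φ t, z =>
      ∑ f ∈ (Fintype.piFinset fun U : W => (M.tuples U.1.arity).powerset) with
          φ.Sat M (z.overRel W f),
        t.eval M (z.overRel W f)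

/-! ## Deconstruction schemes -/

/-- `x` is the first `m`-tuple over the set `A` in the (strict) ordering `O`. -/
def IsFirst {m : ℕ} {V : Type} (A : Finset V) (O : (Fin m → V) → (Fin m → V) → Prop)
    (x : Fin m → V) : Prop :=
  (∀ j, x j ∈ A) ∧ ∀ y : Fin m → V, (∀ j, y j ∈ A) → y ≠ x → O x y

/-- `O` is a (strict) linear ordering of the `m`-tuples over the set `A`. -/
structure IsLinear {m : ℕ} {V : Type} (A : Finset V)
    (O : (Fin m → V) → (Fin m → V) → Prop) : Prop where
  mem : ∀ s t, O s t → ∀ j, s j ∈ A ∧ t j ∈ A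
  irrefl : ∀ s, ¬ O s s
  trans : ∀ s t u, O s t → O t u → O s u
  total : ∀ s t : Fin m → V, (∀ j, s j ∈ A) → (∀ j, t j ∈ A) → s ≠ t → O s t ∨ O t s

/-- A translation scheme from `τ ∪ {a_1, …, a_m, O}` to itself: a formula `φ(v_0)` for the universe,
formulas `ψ_r(v_0, …)` for the relations of `τ`, and a formula for `O`. -/
structure Scheme (τ : Vocabulary) (m : ℕ) where
  dom : Formula τ m
  dom_free : dom.FreeBelow 1
  rel : Fin τ.numRel → Formula τ m
  rel_free : ∀ r, (rel r).FreeBelow (τ.arity r)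
  ord : Formula τ m
  ord_free : ord.FreeBelow (m + m)

open Classical in
/-- The universe of the transduct. -/
noncomputable def Scheme.newUniv {τ : Vocabulary} {m : ℕ} {V : Type} (T : Scheme τ m)
    (M : OrdGraph τ m V) : Finset V :=
  {a ∈ M.univ | M.Holds T.dom (fun _ : Fin 1 => a)}

/-- The ordering of the transduct. -/
def Scheme.newOrd {τ : Vocabulary} {m : ℕ} {V : Type} (T : Scheme τ m) (M : OrdGraph τ m V)
    (s t : Fin m → V) : Prop :=
  (∀ j, s j ∈ T.newUniv M ∧ t j ∈ T.newUniv M) ∧ M.Holds T.ord (Fin.append s t)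

open Classical in
/-- The transduct `T*[M]`. Its context is the first tuple in its ordering. If there is no such tuple
(as in the empty graph) the context is irrelevant, and it is left unchanged. -/
noncomputable def Scheme.star {τ : Vocabulary} {m : ℕ} {V : Type} (T : Scheme τ m)
    (M : OrdGraph τ m V) : OrdGraph τ m V where
  univ := T.newUniv M
  rel r t := (∀ j, t j ∈ T.newUniv M) ∧ M.Holds (T.rel r) t
  rel_mem _ _ h := h.1
  ctx := if h : ∃ x, IsFirst (T.newUniv M) (T.newOrd M) x then h.choose else M.ctx
  ord := T.newOrd M

/-! ## Recursive definitions of graph polynomials -/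

/-- A class of graphs (for instance all graphs in the sense of one of the two vocabularies). -/
abbrev GraphClass (τ : Vocabulary) : Type 1 := ∀ V : Type, Set (Graph τ V)

/-- The data of a recursive definition: finitely many translation schemes `T_i`, guards `φ_i`,
coefficients `σ_i`, and the formula `φ_ord`. -/
structure RecDef (τ : Vocabulary) (m ℓ : ℕ) (R : Type*) where
  scheme : Fin ℓ → Scheme τ m
  guard : Fin ℓ → Formula τ m
  coeff : Fin ℓ → PolyExpr τ m R
  ordFormula : Formula τ m

/-- `VALORD`: the graphs of the class `K` with a context `x` and an ordering `O` of the contexts,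
such that `O` is linear, `x` is its first element, and `⟨G, x, O⟩ ⊨ φ_ord`. -/
structure RecDef.IsValord {τ : Vocabulary} {m ℓ : ℕ} {R : Type*} (D : RecDef τ m ℓ R)
    (K : GraphClass τ) {V : Type} (M : OrdGraph τ m V) : Prop where
  graph_mem : M.toGraph ∈ K V
  linear : IsLinear M.univ M.ord
  first : IsFirst M.univ M.ord M.ctx
  models : M.Models D.ordFormula

/-- The deconstruction tree `Γ(M)`: the leaves are marked by the empty graph; an internal node is
marked by a nonempty graph on which some guard holds, and it has, for each `i` whose guard holds, a
child marked by `T_i*[M]`. -/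
inductive DeconTree {τ : Vocabulary} {m ℓ : ℕ} {R : Type*} (D : RecDef τ m ℓ R) {V : Type} :
    OrdGraph τ m V → Type _
  | leaf (M : OrdGraph τ m V) (h : M.univ = ∅) : DeconTree D M
  | node (M : OrdGraph τ m V) (h : M.univ.Nonempty) (he : ∃ i, M.Models (D.guard i))
      (child : ∀ i, M.Models (D.guard i) → DeconTree D ((D.scheme i).star M)) : DeconTree D M

/-- Some assignment in a nonempty graph, at which expressions without free variables are
evaluated. -/
noncomputable def OrdGraph.someAssign {τ : Vocabulary} {m : ℕ} {V : Type} (M : OrdGraph τ m V)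
    (h : M.univ.Nonempty) : Assign V :=
  ⟨fun _ => h.choose, fun _ => ∅⟩

open Classical in
/-- The valuation `P(Γ)` of a deconstruction tree: leaves have the value `1`, and an internal node
marked by `M` has the value `∑ σ_i(M) · P(T_i*[M])`, where `i` ranges over the enabled indices. -/
noncomputable def DeconTree.value {τ : Vocabulary} {m ℓ : ℕ} {R : Type*} [CommSemiring R]
    {D : RecDef τ m ℓ R} {V : Type} {M : OrdGraph τ m V} : DeconTree D M → R
  | .leaf _ _ => 1
  | .node M h _ child =>
      ∑ i, if hi : M.Models (D.guard i) then
        (D.coeff i).eval M (M.someAssign h) * (child i hi).value else 0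

/-- `(T_i, φ_i)` is a guarded deconstruction along `VALORD`: on each member of `VALORD` on which it
is enabled, it properly shrinks the universe, deletes an element of the context, restricts the
ordering, and yields a member of `VALORD` unless it yields the empty graph. -/
structure RecDef.IsDecon {τ : Vocabulary} {m ℓ : ℕ} {R : Type*} (D : RecDef τ m ℓ R)
    (K : GraphClass τ) (i : Fin ℓ) : Prop where
  guard_sentence : (D.guard i).IsSentence
  ssubset : ∀ (V : Type) (M : OrdGraph τ m V), D.IsValord K M → M.Models (D.guard i) →
    ((D.scheme i).star M).univ ⊂ M.univ
  deletes : ∀ (V : Type) (M : OrdGraph τ m V), D.IsValord K M → M.Models (D.guard i) →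
    ∃ j, M.ctx j ∉ ((D.scheme i).star M).univ
  restricts : ∀ (V : Type) (M : OrdGraph τ m V), D.IsValord K M → M.Models (D.guard i) →
    ∀ s t : Fin m → V, (∀ j, s j ∈ ((D.scheme i).star M).univ) →
      (∀ j, t j ∈ ((D.scheme i).star M).univ) → (((D.scheme i).star M).ord s t ↔ M.ord s t)
  valord : ∀ (V : Type) (M : OrdGraph τ m V), D.IsValord K M → M.Models (D.guard i) →
    ((D.scheme i).star M).univ.Nonempty → D.IsValord K ((D.scheme i).star M)

/-- The recursive definition is SOL-feasible (on the class `K` of graphs). -/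
structure RecDef.Feasible {τ : Vocabulary} {m ℓ : ℕ} {R : Type*} [CommSemiring R]
    (D : RecDef τ m ℓ R) (K : GraphClass τ) : Prop where
  /-- the formula `φ_ord` that defines `VALORD` is a sentence -/
  ord_sentence : D.ordFormula.IsSentence
  /-- all `(T_i, φ_i)` are guarded deconstructions along `VALORD` -/
  decon : ∀ i, D.IsDecon K i
  /-- the coefficients are given by short expressions without free variables -/
  coeff_short : ∀ i, (D.coeff i).IsShort
  coeff_closed : ∀ i, (D.coeff i).free = ∅
  /-- every nonempty graph has an expansion in `VALORD` -/
  expansion : ∀ (V : Type) (G : Graph τ V), G ∈ K V → G.univ.Nonempty →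
    ∃ M : OrdGraph τ m V, M.toGraph = G ∧ D.IsValord K M
  /-- every member of `VALORD` has a deconstruction tree -/
  tree : ∀ (V : Type) (M : OrdGraph τ m V), D.IsValord K M → Nonempty (DeconTree D M)
  /-- the valuation does not depend on the ordering -/
  invariant : ∀ (V : Type) (M₁ M₂ : OrdGraph τ m V), D.IsValord K M₁ → D.IsValord K M₂ →
    M₁.toGraph = M₂.toGraph → ∀ (Γ₁ : DeconTree D M₁) (Γ₂ : DeconTree D M₂), Γ₁.value = Γ₂.value

end SOL

/-! A short coefficient is a finite sum of bounded sums of monomials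
(`PolyExpr.IsShort.exists_sum_tuples`). By distributivity, the valuation of a deconstruction tree is
therefore a sum over runs: descents from the root which choose, at each graph, an enabled index i, a
branch of σ_i and a tuple for the bounded sum of that branch, until the empty graph is reached. The
weight of a run is the product of the monomials chosen. A long sum can range over runs, and a
bounded product can compute weights, once runs are coded by relations on A.

The contexts make this possible. Each step deletes a component of the current context and restricts
the ordering, so the contexts along a run strictly increase in O, and no m-tuple occurs twice. A run
is thus a labelling of A^m: the label at a context y that occurs lists the universe and the
relations of the current graph together with the choice made there, and all other labels are empty.
The ordering and the context need no code, being the restriction of O and y itself. A family of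
k-ary relations indexed by m-tuples is a single relation of arity m + k.

Two things remain. On the logical side, SOL truth in a coded graph is definable in the ambient graph
(`Definable.sat_stateAt`); hence so are guards, transductions and the property of describing a run
(`Steps.definable_runOn`), and the weight is a monomial expression (`Steps.monoDefinable_weight`).
On the algebraic side, a run splits into its first label and a run from the next context
(`LabelSystem.runSum_eq_sum`), and the admissible labels at a graph correspond to the choices there
(`Steps.sum_labels`). So sums over runs obey the recursion of the valuation, and induction on the
tree gives `Steps.runSumFrom_eq_value`. -/

namespace SOL

/-! ### Closure properties of definable predicates and of monomial functions. -/

variable {τ : Vocabulary} {m : ℕ} {ι : Type}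

/-! ## Definable predicates -/

/-- Interpretations of the relation variables in `V`. -/
abbrev RelAssign (V : Type) : Type := (U : RelVar) → Finset (Fin U.arity → V)

/-- Predicates of ordered graphs, families of elements, and relations. -/
abbrev Pred (τ : Vocabulary) (m : ℕ) (ι : Type) : Type 1 :=
  ∀ V : Type, OrdGraph τ m V → (ι → V) → RelAssign V → Prop

/-- `P` is defined by an SOL-formula, whatever individual variables name its arguments. -/
def Definable (P : Pred τ m ι) : Prop :=
  ∀ e : ι → ℕ, ∃ φ : Formula τ m, ∀ (V : Type) (M : OrdGraph τ m V), ∀ z ∈ M.Ass,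
    (φ.Sat M z ↔ P V M (z.ind ∘ e) z.rel)

theorem Graph.Ass.setInd {V : Type} {G : Graph τ V} {z : Assign V} (hz : z ∈ G.Ass) (i : ℕ) {a : V}
    (ha : a ∈ G.univ) : z.setInd i a ∈ G.Ass := by
  refine ⟨fun j => ?_, hz.2⟩
  by_cases h : j = i
  · subst h; simpa [Assign.setInd] using ha
  · simpa [Assign.setInd, h] using hz.1 j

theorem Graph.Ass.setRel {V : Type} {G : Graph τ V} {z : Assign V} (hz : z ∈ G.Ass) (U : RelVar)
    {Q : Finset (Fin U.arity → V)} (hQ : Q ⊆ G.tuples U.arity) : z.setRel U Q ∈ G.Ass := by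
  refine ⟨hz.1, fun U' => ?_⟩
  by_cases h : U' = U
  · subst h; simpa [Assign.setRel] using hQ
  · simpa [Assign.setRel, h] using hz.2 U'

theorem Graph.mem_tuples {V : Type} {G : Graph τ V} {n : ℕ} {t : Fin n → V} :
    t ∈ G.tuples n ↔ ∀ j, t j ∈ G.univ := by
  simp [Graph.tuples, Fintype.mem_piFinset]

namespace Definable

/-- Formulas are tested at assignments in `M` only, so arguments outside the universe do not matter.
This lets bounds on quantified tuples be added or dropped later. -/
theorem congr {P P' : Pred τ m ι} (h : Definable P)
    (hP : ∀ V (M : OrdGraph τ m V) x W, (∀ i, x i ∈ M.univ) → (∀ U, W U ⊆ M.tuples U.arity) →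
      (P' V M x W ↔ P V M x W)) : Definable P' := fun e => by
  obtain ⟨φ, hφ⟩ := h e
  exact ⟨φ, fun V M z hz => (hφ V M z hz).trans (hP V M _ _ (fun i => hz.1 _) hz.2).symm⟩

theorem reindex {κ : Type} {P : Pred τ m κ} (h : Definable P) (r : κ → ι) :
    Definable fun V M (x : ι → V) W => P V M (x ∘ r) W := fun e => h (e ∘ r)

theorem not {P : Pred τ m ι} (h : Definable P) :
    Definable fun V M x W => ¬ P V M x W := fun e => by
  obtain ⟨φ, hφ⟩ := h e
  exact ⟨.not φ, fun V M z hz => not_congr (hφ V M z hz)⟩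

theorem and {P Q : Pred τ m ι} (h : Definable P) (h' : Definable Q) :
    Definable fun V M x W => P V M x W ∧ Q V M x W := fun e => by
  obtain ⟨φ, hφ⟩ := h e
  obtain ⟨ψ, hψ⟩ := h' e
  exact ⟨.and φ ψ, fun V M z hz => and_congr (hφ V M z hz) (hψ V M z hz)⟩

theorem or {P Q : Pred τ m ι} (h : Definable P) (h' : Definable Q) :
    Definable fun V M x W => P V M x W ∨ Q V M x W := fun e => by
  obtain ⟨φ, hφ⟩ := h e
  obtain ⟨ψ, hψ⟩ := h' e
  exact ⟨.or φ ψ, fun V M z hz => or_congr (hφ V M z hz) (hψ V M z hz)⟩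

theorem imp {P Q : Pred τ m ι} (h : Definable P) (h' : Definable Q) :
    Definable fun V M x W => P V M x W → Q V M x W := fun e => by
  obtain ⟨φ, hφ⟩ := h e
  obtain ⟨ψ, hψ⟩ := h' e
  exact ⟨.imp φ ψ, fun V M z hz => imp_congr (hφ V M z hz) (hψ V M z hz)⟩

theorem iff {P Q : Pred τ m ι} (h : Definable P) (h' : Definable Q) :
    Definable fun V M x W => (P V M x W ↔ Q V M x W) :=
  ((h.imp h').and (h'.imp h)).congr fun _ _ _ _ _ _ => iff_iff_implies_and_implies

theorem const (p : Prop) : Definable (τ := τ) (m := m) (ι := ι) fun _ _ _ _ => p := fun e => by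
  by_cases hp : p
  · exact ⟨.eq (.var 0) (.var 0), fun V M z hz => by simp [Formula.Sat, hp]⟩
  · exact ⟨.not (.eq (.var 0) (.var 0)), fun V M z hz => by simp [Formula.Sat, hp]⟩

theorem eq (i j : ι) : Definable (τ := τ) (m := m) fun _ _ x _ => x i = x j := fun e =>
  ⟨.eq (.var (e i)) (.var (e j)), fun _ _ _ _ => Iff.rfl⟩

theorem rel (r : Fin τ.numRel) (t : Fin (τ.arity r) → ι) :
    Definable (τ := τ) (m := m) fun _ M x _ => M.rel r (x ∘ t) := fun e =>
  ⟨.rel r fun j => .var (e (t j)), fun _ _ _ _ => Iff.rfl⟩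

theorem ord (s t : Fin m → ι) :
    Definable (τ := τ) (m := m) fun _ M x _ => M.ord (x ∘ s) (x ∘ t) := fun e =>
  ⟨.ord (fun j => .var (e (s j))) fun j => .var (e (t j)), fun _ _ _ _ => Iff.rfl⟩

theorem relVar (U : RelVar) (t : Fin U.arity → ι) :
    Definable (τ := τ) (m := m) fun _ _ x W => x ∘ t ∈ W U := fun e =>
  ⟨.relVar U fun j => .var (e (t j)), fun _ _ _ _ => Iff.rfl⟩

theorem forallFinite {κ : Type} [Finite κ] {P : κ → Pred τ m ι} (h : ∀ k, Definable (P k)) :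
    Definable fun V M x W => ∀ k, P k V M x W := by
  classical
  have := Fintype.ofFinite κ
  have key : ∀ s : Finset κ, Definable fun V M x W => ∀ k ∈ s, P k V M x W := by
    intro s
    induction s using Finset.induction_on with
    | empty => exact (const True).congr fun _ _ _ _ _ _ => by simp
    | insert a s ha ih => exact ((h a).and ih).congr fun _ _ _ _ _ _ => by simp
  exact (key Finset.univ).congr fun _ _ _ _ _ _ => by simp

theorem existsFinite {κ : Type} [Finite κ] {P : κ → Pred τ m ι} (h : ∀ k, Definable (P k)) :
    Definable fun V M x W => ∃ k, P k V M x W :=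
  (forallFinite fun k => (h k).not).not.congr fun _ _ _ _ _ _ => by simp

/-- As ι is finite, some name lies outside the range of `e` and can be bound. `Definable` allows
every naming `e`, so formulas never have to be renamed. -/
theorem existsInd [Finite ι] {P : Pred τ m (Option ι)} (h : Definable P) :
    Definable fun V M x W => ∃ a ∈ M.univ, P V M (fun o => o.elim a x) W := fun e => by
  obtain ⟨k, hk⟩ := Infinite.exists_notMem_finset (Set.finite_range e).toFinset
  obtain ⟨φ, hφ⟩ := h (fun o => o.elim k e)
  refine ⟨.exInd k φ, fun V M z hz => exists_congr fun a => and_congr_right fun ha => ?_⟩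
  rw [hφ V M _ (Graph.Ass.setInd hz k ha)]
  have : (z.setInd k a).ind ∘ (fun o : Option ι => o.elim k e)
      = fun o => o.elim a (z.ind ∘ e) := by
    funext o
    cases o with
    | none => simp [Assign.setInd]
    | some i =>
      have : e i ≠ k := fun h => hk (by simp [← h])
      simp [Assign.setInd, this]
  rw [this]; rfl

theorem existsTuple [Finite ι] {n : ℕ} {P : Pred τ m (ι ⊕ Fin n)} (h : Definable P) :
    Definable fun V M x W => ∃ y : Fin n → V, (∀ k, y k ∈ M.univ) ∧ P V M (Sum.elim x y) W := by
  induction n generalizing ι with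
  | zero =>
    refine (h.reindex (Sum.elim id Fin.elim0)).congr fun V M x W _ _ => ?_
    have (y : Fin 0 → V) : Sum.elim x y = x ∘ Sum.elim id Fin.elim0 := by
      funext j; rcases j with j | j
      · rfl
      · exact j.elim0
    simp [this]
  | succ n ih =>
    let r : ι ⊕ Fin (n + 1) → Option ι ⊕ Fin n :=
      Sum.elim (Sum.inl ∘ some) (Fin.cons (Sum.inl none) Sum.inr)
    refine (existsInd (ih (h.reindex r))).congr fun V M x W _ _ => ?_
    rw [Fin.exists_fin_succ_pi]
    have (a : V) (y : Fin n → V) : Sum.elim (fun o : Option ι => o.elim a x) y ∘ r =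
        Sum.elim x (Fin.cons a y : Fin (n + 1) → V) := by
      funext j; rcases j with j | j
      · rfl
      · refine Fin.cases ?_ (fun j => ?_) j <;> simp [r]
    simp [this, Fin.forall_fin_succ, and_assoc]

theorem forallTuple [Finite ι] {n : ℕ} {P : Pred τ m (ι ⊕ Fin n)} (h : Definable P) :
    Definable fun V M x W => ∀ y : Fin n → V, (∀ k, y k ∈ M.univ) → P V M (Sum.elim x y) W :=
  h.not.existsTuple.not.congr fun _ _ _ _ _ _ => by simp

theorem existsRel (U : RelVar) {P : Pred τ m ι} (h : Definable P) :
    Definable fun V M x W => ∃ Q ⊆ M.tuples U.arity, P V M x (Function.update W U Q) := fun e => by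
  obtain ⟨φ, hφ⟩ := h e
  exact ⟨.exRel U φ, fun V M z hz => exists_congr fun Q => and_congr_right fun hQ =>
    hφ V M _ (Graph.Ass.setRel hz U hQ)⟩

end Definable

/-! ## Functions given by monomial expressions -/

universe u

variable {R : Type u}

/-- Functions on ordered graphs with families of elements and relations. -/
abbrev Fun (τ : Vocabulary) (m : ℕ) (R : Type u) (ι : Type) : Type (max 1 u) :=
  ∀ V : Type, OrdGraph τ m V → (ι → V) → RelAssign V → R

variable [CommSemiring R]

/-- `F` is the value of an SOL-monomial expression, whatever individual variables name its
arguments. -/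
def MonoDefinable (F : Fun τ m R ι) : Prop :=
  ∀ e : ι → ℕ, ∃ t : MonoExpr τ m R, ∀ (V : Type) (M : OrdGraph τ m V), ∀ z ∈ M.Ass,
    t.eval M z = F V M (z.ind ∘ e) z.rel

theorem Graph.Ass.overInd {V : Type} {G : Graph τ V} {z : Assign V} (hz : z ∈ G.Ass) (a : Finset ℕ)
    {f : a → V} (hf : ∀ i, f i ∈ G.univ) : z.overInd a f ∈ G.Ass := by
  refine ⟨fun j => ?_, hz.2⟩
  by_cases h : j ∈ a
  · simpa [Assign.overInd, h] using hf _
  · simpa [Assign.overInd, h] using hz.1 j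

theorem Graph.Ass.overRel {V : Type} {G : Graph τ V} {z : Assign V} (hz : z ∈ G.Ass)
    (W : Finset RelVar) {f : (U : W) → Finset (Fin U.1.arity → V)}
    (hf : ∀ U, f U ⊆ G.tuples U.1.arity) : z.overRel W f ∈ G.Ass := by
  refine ⟨hz.1, fun U => ?_⟩
  by_cases h : U ∈ W
  · simpa [Assign.overRel, h] using hf ⟨U, h⟩
  · simpa [Assign.overRel, h] using hz.2 U

namespace MonoDefinable

theorem congr {F F' : Fun τ m R ι} (h : MonoDefinable F)
    (hF : ∀ V (M : OrdGraph τ m V) x W, (∀ i, x i ∈ M.univ) → (∀ U, W U ⊆ M.tuples U.arity) →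
      F' V M x W = F V M x W) : MonoDefinable F' := fun e => by
  obtain ⟨t, ht⟩ := h e
  exact ⟨t, fun V M z hz => (ht V M z hz).trans (hF V M _ _ (fun i => hz.1 _) hz.2).symm⟩

theorem const (a : R) : MonoDefinable (τ := τ) (m := m) (ι := ι) fun _ _ _ _ => a := fun _ =>
  ⟨.const a, fun _ _ _ _ => rfl⟩

open Classical in
theorem tv {P : Pred τ m ι} (h : Definable P) :
    MonoDefinable (R := R) fun V M x W => if P V M x W then 1 else 0 := fun e => by
  obtain ⟨φ, hφ⟩ := h e
  exact ⟨.tv φ, fun V M z hz => by simp only [MonoExpr.eval, hφ V M z hz]⟩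

theorem prod {κ : Type} [Fintype κ] {F : κ → Fun τ m R ι} (h : ∀ k, MonoDefinable (F k)) :
    MonoDefinable fun V M x W => ∏ k, F k V M x W := fun e => by
  choose t ht using fun k => h k e
  refine ⟨.prod (Fintype.card κ) fun j => t ((Fintype.equivFin κ).symm j), fun V M z hz => ?_⟩
  simp only [MonoExpr.eval, ht _ V M z hz]
  exact Equiv.prod_comp (Fintype.equivFin κ).symm fun k => F k V M (z.ind ∘ e) z.rel

open Classical in
theorem bprod [Finite ι] {κ : Type} [Fintype κ] {P : Pred τ m (ι ⊕ κ)} {F : Fun τ m R (ι ⊕ κ)}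
    (hP : Definable P) (hF : MonoDefinable F) :
    MonoDefinable fun V M x W =>
      ∏ y ∈ (Fintype.piFinset fun _ : κ => M.univ) with P V M (Sum.elim x y) W,
        F V M (Sum.elim x y) W := fun e => by
  obtain ⟨b, hb⟩ : ∃ b, ∀ i, e i < b := by
    obtain ⟨b, hb⟩ := (Set.finite_range e).bddAbove
    exact ⟨b + 1, fun i => Nat.lt_succ_of_le (hb ⟨i, rfl⟩)⟩
  -- The bound names b, b + 1, … lie above all names in the range of `e`, so no argument is
  -- captured.
  let g : κ ↪ ℕ := ((Fintype.equivFin κ).toEmbedding.trans Fin.valEmbedding).trans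
    (addLeftEmbedding b)
  have hg : ∀ k i, g k ≠ e i := fun k i h => by
    have := hb i
    have h2 : g k = b + Fintype.equivFin κ k := rfl
    omega
  obtain ⟨φ, hφ⟩ := hP (Sum.elim e g)
  obtain ⟨t, ht⟩ := hF (Sum.elim e g)
  let a : Finset ℕ := Finset.univ.map g
  have hga : ∀ k, g k ∈ a := fun k => by simp [a]
  let E : κ ≃ a := Equiv.ofBijective (fun k => ⟨g k, hga k⟩)
    ⟨fun k k' h => g.injective (by simpa using h), fun ⟨i, hi⟩ => by
      obtain ⟨k, -, hk⟩ := Finset.mem_map.1 hi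
      exact ⟨k, Subtype.ext hk⟩⟩
  refine ⟨.bprod a φ t, fun V M z hz => ?_⟩
  have key : ∀ f : a → V, (∀ i, f i ∈ M.univ) → z.overInd a f ∈ M.Ass ∧
      (z.overInd a f).ind ∘ Sum.elim e g = Sum.elim (z.ind ∘ e) (f ∘ E) := fun f hf => by
    refine ⟨Graph.Ass.overInd hz a hf, ?_⟩
    funext j
    rcases j with j | k
    · have : e j ∉ a := fun h => by
        obtain ⟨k, -, hk⟩ := Finset.mem_map.1 h
        exact hg k j hk
      simp [Assign.overInd, this]
    · exact dif_pos (hga k)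
  refine Finset.prod_equiv (E.symm.arrowCongr (Equiv.refl V)) (fun f => ?_) (fun f hf => ?_)
  · simp only [Finset.mem_filter, Fintype.mem_piFinset]
    have hE : E.symm.arrowCongr (Equiv.refl V) f = f ∘ E := by
      funext i; simp [Equiv.arrowCongr]
    rw [hE]
    refine ⟨fun ⟨h1, h2⟩ => ⟨fun k => h1 _, ?_⟩, fun ⟨h1, h2⟩ => ?_⟩
    · rw [hφ V M _ (key f h1).1, (key f h1).2] at h2
      exact h2
    · have h1' : ∀ i, f i ∈ M.univ := fun i => by simpa using h1 (E.symm i)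
      refine ⟨h1', ?_⟩
      rw [hφ V M _ (key f h1').1, (key f h1').2]
      exact h2
  · simp only [Finset.mem_filter, Fintype.mem_piFinset] at hf
    rw [ht V M _ (key f hf.1).1, (key f hf.1).2]
    congr 1

end MonoDefinable

end SOL

/-! ### Dependence on free variables, and truth in structures coded by relations. -/

namespace SOL

variable {τ : Vocabulary} {m : ℕ} {ι : Type}

/-! ## Values depend on the free variables only -/

/-- The assignments `z` and `z'` agree on the variables in `s`. -/
def Assign.AgreeOn {V : Type} (s : Set Var) (z z' : Assign V) : Prop :=
  (∀ i, Sum.inl i ∈ s → z.ind i = z'.ind i) ∧ ∀ U, Sum.inr U ∈ s → z.rel U = z'.rel U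

namespace Assign.AgreeOn

variable {V : Type} {s t : Set Var} {z z' : Assign V}

theorem mono (h : AgreeOn t z z') (hst : s ⊆ t) : AgreeOn s z z' :=
  ⟨fun i hi => h.1 i (hst hi), fun U hU => h.2 U (hst hU)⟩

theorem empty : AgreeOn ∅ z z' := ⟨fun _ h => h.elim, fun _ h => h.elim⟩

theorem setInd {i : ℕ} (h : AgreeOn (s \ {Sum.inl i}) z z') (a : V) :
    AgreeOn s (z.setInd i a) (z'.setInd i a) := by
  refine ⟨fun j hj => ?_, fun U hU => h.2 U ⟨hU, by simp⟩⟩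
  by_cases hji : j = i
  · subst hji; simp [Assign.setInd]
  · simpa [Assign.setInd, hji] using h.1 j ⟨hj, by simpa using hji⟩

theorem setRel {U : RelVar} (h : AgreeOn (s \ {Sum.inr U}) z z') (Q : Finset (Fin U.arity → V)) :
    AgreeOn s (z.setRel U Q) (z'.setRel U Q) := by
  refine ⟨fun j hj => h.1 j ⟨hj, by simp⟩, fun U' hU' => ?_⟩
  by_cases hU : U' = U
  · subst hU; simp [Assign.setRel]
  · simpa [Assign.setRel, hU] using h.2 U' ⟨hU', by simpa using hU⟩

theorem overInd {a : Finset ℕ} (h : AgreeOn (s \ (Sum.inl '' (a : Set ℕ))) z z') (f : a → V) :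
    AgreeOn s (z.overInd a f) (z'.overInd a f) := by
  refine ⟨fun j hj => ?_, fun U hU => h.2 U ⟨hU, by simp⟩⟩
  by_cases hja : j ∈ a
  · simp [Assign.overInd, hja]
  · simpa [Assign.overInd, hja] using h.1 j ⟨hj, by simpa using hja⟩

theorem overRel {W : Finset RelVar} (h : AgreeOn (s \ (Sum.inr '' (W : Set RelVar))) z z')
    (f : (U : W) → Finset (Fin U.1.arity → V)) :
    AgreeOn s (z.overRel W f) (z'.overRel W f) := by
  refine ⟨fun j hj => h.1 j ⟨hj, by simp⟩, fun U hU => ?_⟩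
  by_cases hUW : U ∈ W
  · simp [Assign.overRel, hUW]
  · simpa [Assign.overRel, hUW] using h.2 U ⟨hU, by simpa using hUW⟩

end Assign.AgreeOn

theorem Term.eval_congr {V : Type} (M : OrdGraph τ m V) {t : Term m} {z z' : Assign V}
    (h : Assign.AgreeOn t.free z z') : t.eval M z = t.eval M z' := by
  cases t with
  | var i => exact h.1 i rfl
  | con j => rfl

theorem Term.eval_comp_congr {V : Type} (M : OrdGraph τ m V) {n : ℕ} {t : Fin n → Term m}
    {z z' : Assign V} (h : Assign.AgreeOn (⋃ j, (t j).free) z z') :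
    (fun j => (t j).eval M z) = fun j => (t j).eval M z' :=
  funext fun j => Term.eval_congr M (h.mono (Set.subset_iUnion (fun j => (t j).free) j))

theorem Formula.sat_congr {V : Type} (M : OrdGraph τ m V) {φ : Formula τ m} {z z' : Assign V}
    (h : Assign.AgreeOn φ.free z z') : φ.Sat M z ↔ φ.Sat M z' := by
  induction φ generalizing z z' with
  | eq s t =>
    simp only [Sat, Term.eval_congr M (h.mono Set.subset_union_left),
      Term.eval_congr M (h.mono Set.subset_union_right)]
  | rel r t => simp only [Sat, Term.eval_comp_congr M h]
  | ord s t =>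
    simp only [Sat, Term.eval_comp_congr M (h.mono Set.subset_union_left),
      Term.eval_comp_congr M (h.mono Set.subset_union_right)]
  | relVar U t =>
    simp only [Sat, Term.eval_comp_congr M (h.mono Set.subset_union_right), h.2 U (Or.inl rfl)]
  | or φ ψ ihφ ihψ =>
    exact or_congr (ihφ (h.mono Set.subset_union_left)) (ihψ (h.mono Set.subset_union_right))
  | and φ ψ ihφ ihψ =>
    exact and_congr (ihφ (h.mono Set.subset_union_left)) (ihψ (h.mono Set.subset_union_right))
  | imp φ ψ ihφ ihψ =>
    exact imp_congr (ihφ (h.mono Set.subset_union_left)) (ihψ (h.mono Set.subset_union_right))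
  | not φ ih => exact not_congr (ih h)
  | exInd i φ ih => exact exists_congr fun a => and_congr_right fun _ => ih (h.setInd a)
  | allInd i φ ih => exact forall₂_congr fun a _ => ih (h.setInd a)
  | exRel U φ ih => exact exists_congr fun Q => and_congr_right fun _ => ih (h.setRel Q)
  | allRel U φ ih => exact forall₂_congr fun Q _ => ih (h.setRel Q)

universe u

variable {R : Type u} [CommSemiring R]

open Classical in
theorem MonoExpr.eval_congr {V : Type} (M : OrdGraph τ m V) {t : MonoExpr τ m R} {z z' : Assign V}
    (h : Assign.AgreeOn t.free z z') : t.eval M z = t.eval M z' := by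
  induction t generalizing z z' with
  | const a => rfl
  | tv φ => exact if_congr (Formula.sat_congr M h) rfl rfl
  | prod n t ih =>
    exact Finset.prod_congr rfl fun j _ =>
      ih j (h.mono (Set.subset_iUnion (fun j => (t j).free) j))
  | bprod a φ t ih =>
    refine Finset.prod_congr (Finset.filter_congr fun f _ => ?_) fun f _ => ?_
    · exact Formula.sat_congr M ((h.overInd f).mono Set.subset_union_right)
    · exact ih ((h.overInd f).mono Set.subset_union_left)

open Classical in
theorem PolyExpr.eval_congr {V : Type} (M : OrdGraph τ m V) {S : PolyExpr τ m R} {z z' : Assign V}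
    (h : Assign.AgreeOn S.free z z') : S.eval M z = S.eval M z' := by
  induction S generalizing z z' with
  | mono t => exact MonoExpr.eval_congr M h
  | sum n t ih =>
    exact Finset.sum_congr rfl fun j _ =>
      ih j (h.mono (Set.subset_iUnion (fun j => (t j).free) j))
  | bsum a φ t ih =>
    refine Finset.sum_congr (Finset.filter_congr fun f _ => ?_) fun f _ => ?_
    · exact Formula.sat_congr M ((h.overInd f).mono Set.subset_union_right)
    · exact ih ((h.overInd f).mono Set.subset_union_left)
  | lsum W φ t ih =>
    refine Finset.sum_congr (Finset.filter_congr fun f _ => ?_) fun f _ => ?_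
    · exact Formula.sat_congr M ((h.overRel f).mono Set.subset_union_right)
    · exact ih ((h.overRel f).mono Set.subset_union_left)

theorem OrdGraph.someAssign_mem {V : Type} (M : OrdGraph τ m V) (h : M.univ.Nonempty) :
    M.someAssign h ∈ M.Ass :=
  ⟨fun _ => h.choose_spec, fun _ => Finset.empty_subset _⟩

/-- Only the values at v_0, …, v_{n-1} matter, so one assignment decides. It need not be an
assignment in `M`: dummy values outside the universe are allowed for the other variables. -/
theorem OrdGraph.holds_iff {V : Type} {M : OrdGraph τ m V} {n : ℕ} {φ : Formula τ m}
    (hφ : φ.FreeBelow n) {b : Fin n → V} (hb : ∀ j, b j ∈ M.univ) (hM : M.univ.Nonempty)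
    {z : Assign V} (hz : ∀ j : Fin n, z.ind j = b j) : M.Holds φ b ↔ φ.Sat M z := by
  have key : ∀ z z' : Assign V, (∀ j : Fin n, z.ind j = b j) → (∀ j : Fin n, z'.ind j = b j) →
      (φ.Sat M z ↔ φ.Sat M z') := fun z z' hz hz' => by
    refine Formula.sat_congr M ⟨fun i hi => ?_, fun U hU => ?_⟩
    · obtain ⟨j, hj, hji⟩ := hφ hi
      obtain rfl := Sum.inl_injective hji
      exact (hz ⟨j, hj⟩).trans (hz' ⟨j, hj⟩).symm
    · obtain ⟨j, -, hj⟩ := hφ hU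
      cases hj
  refine ⟨fun h => ?_, fun h z' _ hz' => (key z z' hz hz').1 h⟩
  obtain ⟨a, ha⟩ := hM
  let z' : Assign V := ⟨fun i => if h : i < n then b ⟨i, h⟩ else a, fun _ => ∅⟩
  have hz' : ∀ j : Fin n, z'.ind j = b j := fun j => by simp [z']
  refine (key z' z hz' hz).1 (h z' ⟨fun i => ?_, fun U => Finset.empty_subset _⟩ hz')
  by_cases hi : i < n
  · simpa [z', hi] using hb _
  · simpa [z', hi] using ha

theorem OrdGraph.models_iff {V : Type} {M : OrdGraph τ m V} {φ : Formula τ m}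
    (hφ : φ.IsSentence) (hM : M.univ.Nonempty) (z : Assign V) : M.Models φ ↔ φ.Sat M z := by
  have key : ∀ z z' : Assign V, (φ.Sat M z ↔ φ.Sat M z') := fun z z' =>
    Formula.sat_congr M (by rw [show φ.free = ∅ from hφ]; exact Assign.AgreeOn.empty)
  exact ⟨fun h => (key _ _).1 (h _ (M.someAssign_mem hM)), fun h z' _ => (key z z').1 h⟩

/-! ## Structures coded by relations -/

/-- The arities of the relations that code the universe and the relations of a graph. -/
def codeArity (τ : Vocabulary) : Option (Fin τ.numRel) → ℕ
  | none => 1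
  | some r => τ.arity r

open Classical in
/-- The substructure of `M` with context `y` whose universe and relations are coded by `s`. -/
noncomputable def coded {V : Type} (M : OrdGraph τ m V) (y : Fin m → V)
    (s : ∀ q, Finset (Fin (codeArity τ q) → V)) : OrdGraph τ m V where
  univ := {a ∈ M.univ | (fun _ => a) ∈ s none}
  rel r t := (∀ j, t j ∈ {a ∈ M.univ | (fun _ => a) ∈ s none}) ∧ t ∈ s (some r)
  rel_mem _ _ h := h.1
  ctx := y
  ord u v := (∀ j, u j ∈ {a ∈ M.univ | (fun _ => a) ∈ s none} ∧
    v j ∈ {a ∈ M.univ | (fun _ => a) ∈ s none}) ∧ M.ord u v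

/-- The relation variables reserved for coding: families of `k`-ary relations that are indexed by
`m`-tuples. -/
abbrev auxVar (hm : 0 < m) (k i : ℕ) : RelVar := ⟨m + k, 2 * i, Nat.le_add_right_of_le hm⟩

/-- The relation variables not reserved for coding. -/
abbrev RelVar.shift (U : RelVar) : RelVar := ⟨U.arity, 2 * U.idx + 1, U.pos⟩

/-- Numbers for the relations that code a graph. -/
def codeIdx (τ : Vocabulary) : Option (Fin τ.numRel) → ℕ
  | none => 0
  | some r => r + 1

open Classical in
/-- The member of index `y` of the family of relations assigned to a reserved relation variable. -/
noncomputable def slice (hm : 0 < m) {V : Type} (M : OrdGraph τ m V) (W : RelAssign V)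
    (y : Fin m → V) (k i : ℕ) : Finset (Fin k → V) :=
  {t ∈ M.tuples k | Fin.append y t ∈ W (auxVar hm k i)}

/-- The structure coded by the relations of index `y`. -/
noncomputable def stateAt (hm : 0 < m) {V : Type} (M : OrdGraph τ m V) (W : RelAssign V)
    (y : Fin m → V) : OrdGraph τ m V :=
  coded M y fun q => slice hm M W y (codeArity τ q) (codeIdx τ q)

theorem coded_univ_subset {V : Type} (M : OrdGraph τ m V) (y : Fin m → V)
    (s : ∀ q, Finset (Fin (codeArity τ q) → V)) : (coded M y s).univ ⊆ M.univ := by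
  classical exact Finset.filter_subset _ _

theorem stateAt_univ_subset (hm : 0 < m) {V : Type} (M : OrdGraph τ m V) (W : RelAssign V)
    (y : Fin m → V) : (stateAt hm M W y).univ ⊆ M.univ :=
  coded_univ_subset M y _

theorem comp_append {α β : Type} {n k : ℕ} (f : α → β) (a : Fin n → α) (b : Fin k → α) :
    f ∘ Fin.append a b = Fin.append (f ∘ a) (f ∘ b) := by
  funext j
  refine Fin.addCases (fun i => ?_) (fun i => ?_) j <;> simp

theorem auxVar_ne_shift (hm : 0 < m) (k i : ℕ) (U : RelVar) : auxVar hm k i ≠ U.shift := fun h => by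
  have := congrArg RelVar.idx h
  simp only at this
  omega

theorem RelVar.shift_injective : Function.Injective RelVar.shift := fun U U' h => by
  cases U; cases U'
  simp only [RelVar.shift, RelVar.mk.injEq] at h ⊢
  omega

/-- Reserved variables have even index and shifted ones odd index, so a relation quantifier inside a
translated formula cannot disturb the code. -/
theorem stateAt_update (hm : 0 < m) {V : Type} (M : OrdGraph τ m V) (W : RelAssign V)
    (y : Fin m → V) (U : RelVar) (Q : Finset (Fin U.arity → V)) :
    stateAt hm M (Function.update W U.shift Q) y = stateAt hm M W y := by
  have (k i : ℕ) : slice hm M (Function.update W U.shift Q) y k i = slice hm M W y k i := by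
    ext t
    simp only [slice, Finset.mem_filter, Function.update_of_ne (auxVar_ne_shift hm k i U)]
  simp only [stateAt, this]

namespace Definable

theorem mem_slice (hm : 0 < m) (c : Fin m → ι) {k : ℕ} (i : ℕ) (t : Fin k → ι) :
    Definable (τ := τ) fun _ M x W => x ∘ t ∈ slice hm M W (x ∘ c) k i := by
  refine (Definable.relVar (auxVar hm k i) (Fin.append c t)).congr fun V M x W hx hW => ?_
  simp only [slice, Finset.mem_filter, Graph.mem_tuples, Function.comp_apply, hx, implies_true,
    true_and, comp_append]

theorem mem_stateAt_univ (hm : 0 < m) (c : Fin m → ι) (a : ι) :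
    Definable (τ := τ) fun _ M x W => x a ∈ (stateAt hm M W (x ∘ c)).univ := by
  refine (mem_slice hm c (k := 1) 0 fun _ => a).congr fun V M x W hx hW => ?_
  simp only [stateAt, coded, Finset.mem_filter, hx, true_and]
  exact Iff.rfl

theorem stateAt_rel (hm : 0 < m) (c : Fin m → ι) (r : Fin τ.numRel) (t : Fin (τ.arity r) → ι) :
    Definable (τ := τ) fun _ M x W => (stateAt hm M W (x ∘ c)).rel r (x ∘ t) :=
  (forallFinite fun j => mem_stateAt_univ hm c (t j)).and
    (mem_slice hm c (codeIdx τ (some r)) t)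

theorem stateAt_ord (hm : 0 < m) (c : Fin m → ι) (s t : Fin m → ι) :
    Definable (τ := τ) fun _ M x W => (stateAt hm M W (x ∘ c)).ord (x ∘ s) (x ∘ t) :=
  (forallFinite fun j => (mem_stateAt_univ hm c (s j)).and (mem_stateAt_univ hm c (t j))).and
    (ord s t)

/-- A quantifier over the coded universe is one over A, guarded by membership in the code. The
witness enters as an additional argument, and the naming sends v_i to it. -/
theorem existsState (hm : 0 < m) [Finite ι] {c : Fin m → ι} {ρ : ℕ → ι} (i : ℕ)
    {p : ∀ V : Type, OrdGraph τ m V → Assign V → Prop}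
    (h : Definable fun V M (x : Option ι → V) W => p V (stateAt hm M W (x ∘ some ∘ c))
      ⟨x ∘ Function.update (some ∘ ρ) i none, fun U => W U.shift⟩) :
    Definable fun V M (x : ι → V) W => ∃ a ∈ (stateAt hm M W (x ∘ c)).univ,
      p V (stateAt hm M W (x ∘ c)) (Assign.setInd ⟨x ∘ ρ, fun U => W U.shift⟩ i a) := by
  refine ((mem_stateAt_univ hm (some ∘ c) none).and h).existsInd.congr fun V M x W _ _ => ?_
  refine exists_congr fun a => ?_
  have h1 : (fun o : Option ι => o.elim a x) ∘ some ∘ c = x ∘ c := rfl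
  have h2 : (fun o : Option ι => o.elim a x) ∘ Function.update (some ∘ ρ) i none =
      Function.update (x ∘ ρ) i a := by
    rw [Function.comp_update]; rfl
  rw [h1, h2]
  refine ⟨fun ⟨ha, h⟩ => ⟨stateAt_univ_subset hm M W _ ha, ha, h⟩, fun h => h.2⟩

/-- The quantified relation is stored at `U.shift`, which leaves the code intact; the guard demands
that all its tuples lie in the coded universe. -/
theorem existsRelState (hm : 0 < m) [Finite ι] {c : Fin m → ι} {ρ : ℕ → ι} (U : RelVar)
    {p : ∀ V : Type, OrdGraph τ m V → Assign V → Prop}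
    (h : Definable fun V M (x : ι → V) W => p V (stateAt hm M W (x ∘ c))
      ⟨x ∘ ρ, fun U => W U.shift⟩) :
    Definable fun V M (x : ι → V) W => ∃ Q ⊆ (stateAt hm M W (x ∘ c)).tuples U.arity,
      p V (stateAt hm M W (x ∘ c)) (Assign.setRel ⟨x ∘ ρ, fun U => W U.shift⟩ U Q) := by
  have hsub : Definable (τ := τ) fun V M (x : ι → V) W =>
      ∀ t : Fin U.arity → V, (∀ k, t k ∈ M.univ) → (t ∈ W U.shift →
        ∀ j, t j ∈ (stateAt hm M W (x ∘ c)).univ) :=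
    forallTuple (P := fun V M x W => x ∘ Sum.inr ∈ W U.shift →
        ∀ j, x (Sum.inr j) ∈ (stateAt hm M W (x ∘ Sum.inl ∘ c)).univ)
      ((relVar U.shift Sum.inr).imp (forallFinite fun j => mem_stateAt_univ hm _ _))
  refine (existsRel U.shift (hsub.and h)).congr fun V M x W _ _ => exists_congr fun Q => ?_
  have hW : (fun U' => Function.update W U.shift Q (RelVar.shift U')) =
      Function.update (fun U' => W (RelVar.shift U')) U Q := by
    funext U'
    by_cases hU : U' = U
    · subst hU; simp
    · rw [Function.update_of_ne hU, Function.update_of_ne fun h => hU (RelVar.shift_injective h)]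
  rw [stateAt_update, hW, Function.update_self]
  refine ⟨fun ⟨hQ, h⟩ => ⟨fun t ht => ?_, fun t _ ht => Graph.mem_tuples.1 (hQ ht), h⟩,
    fun ⟨hQ, hQ', h⟩ => ⟨fun t ht => Graph.mem_tuples.2 (hQ' t ?_ ht), h⟩⟩
  · exact Graph.mem_tuples.2 fun j => stateAt_univ_subset hm M W _ (Graph.mem_tuples.1 (hQ ht) j)
  · exact Graph.mem_tuples.1 (hQ ht)

/-- Relativization, by induction on `φ`: atoms are read off the code, the context constants become
the arguments `c`, the ordering is that of `M`, and quantifiers are guarded. The naming `ρ` has to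
vary because binders change it. -/
theorem sat_stateAt (hm : 0 < m) (φ : Formula τ m) [Finite ι] (c : Fin m → ι) (ρ : ℕ → ι) :
    Definable fun _ M x W =>
      φ.Sat (stateAt hm M W (x ∘ c)) ⟨x ∘ ρ, fun U => W U.shift⟩ := by
  have term : ∀ {ι : Type} (c : Fin m → ι) (ρ : ℕ → ι) (t : Term m), ∃ k : ι,
      ∀ (V : Type) (M : OrdGraph τ m V) (x : ι → V) W,
        t.eval (stateAt hm M W (x ∘ c)) ⟨x ∘ ρ, fun U => W U.shift⟩ = x k := by
    intro ι c ρ t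
    cases t with
    | var i => exact ⟨ρ i, fun _ _ _ _ => rfl⟩
    | con j => exact ⟨c j, fun _ _ _ _ => rfl⟩
  induction φ generalizing ι with
  | eq s t =>
    obtain ⟨i, hi⟩ := term c ρ s
    obtain ⟨j, hj⟩ := term c ρ t
    simp only [Formula.Sat, hi, hj]
    exact eq i j
  | rel r t =>
    choose k hk using fun j => term c ρ (t j)
    simp only [Formula.Sat, hk]
    exact stateAt_rel hm c r k
  | ord s t =>
    choose k hk using fun j => term c ρ (s j)
    choose l hl using fun j => term c ρ (t j)
    simp only [Formula.Sat, hk, hl]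
    exact stateAt_ord hm c k l
  | relVar U t =>
    choose k hk using fun j => term c ρ (t j)
    simp only [Formula.Sat, hk]
    exact relVar U.shift k
  | or φ ψ ihφ ihψ => exact (ihφ c ρ).or (ihψ c ρ)
  | and φ ψ ihφ ihψ => exact (ihφ c ρ).and (ihψ c ρ)
  | imp φ ψ ihφ ihψ => exact (ihφ c ρ).imp (ihψ c ρ)
  | not φ ih => exact (ih c ρ).not
  | exInd i φ ih => exact existsState hm (p := fun _ N z => φ.Sat N z) i (ih _ _)
  | allInd i φ ih =>
    refine (existsState hm (c := c) (ρ := ρ) (p := fun _ N z => ¬ φ.Sat N z) i (ih _ _).not).not.congr fun _ _ _ _ _ _ => ?_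
    simp [Formula.Sat]
  | exRel U φ ih => exact existsRelState hm (p := fun _ N z => φ.Sat N z) U (ih c ρ)
  | allRel U φ ih =>
    refine (existsRelState hm (c := c) (ρ := ρ) (p := fun _ N z => ¬ φ.Sat N z) U (ih c ρ).not).not.congr fun _ _ _ _ _ _ => ?_
    simp [Formula.Sat]

end Definable

end SOL

/-! ### Transductions of coded structures, and the normal form of short expressions. -/

namespace SOL

variable {τ : Vocabulary} {m : ℕ} {ι : Type}

/-! ## Relativization to coded structures -/

/-- `P` is definable, uniformly, in all coded structures. -/
def Relativizable (hm : 0 < m) (P : Pred τ m ι) : Prop :=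
  ∀ (κ : Type) [Finite κ] (c : Fin m → κ) (ρ : ι → κ), Definable fun V M (x : κ → V) W =>
    P V (stateAt hm M W (x ∘ c)) (x ∘ ρ) fun U => W U.shift

namespace Relativizable

variable {hm : 0 < m}

theorem congr {P P' : Pred τ m ι} (h : Relativizable hm P)
    (hP : ∀ V (N : OrdGraph τ m V) x W, P' V N x W ↔ P V N x W) : Relativizable hm P' :=
  fun _ _ c ρ => (h _ c ρ).congr fun _ _ _ _ _ _ => hP _ _ _ _

theorem reindex {κ : Type} {P : Pred τ m κ} (h : Relativizable hm P) (r : κ → ι) :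
    Relativizable hm fun V N (x : ι → V) W => P V N (x ∘ r) W := fun _ _ c ρ => h _ c (ρ ∘ r)

theorem and {P Q : Pred τ m ι} (h : Relativizable hm P) (h' : Relativizable hm Q) :
    Relativizable hm fun V N x W => P V N x W ∧ Q V N x W := fun _ _ c ρ => (h _ c ρ).and (h' _ c ρ)

theorem imp {P Q : Pred τ m ι} (h : Relativizable hm P) (h' : Relativizable hm Q) :
    Relativizable hm fun V N x W => P V N x W → Q V N x W := fun _ _ c ρ => (h _ c ρ).imp (h' _ c ρ)

theorem not {P : Pred τ m ι} (h : Relativizable hm P) :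
    Relativizable hm fun V N x W => ¬ P V N x W := fun _ _ c ρ => (h _ c ρ).not

theorem const (p : Prop) : Relativizable (ι := ι) (τ := τ) hm fun _ _ _ _ => p :=
  fun _ _ _ _ => Definable.const p

theorem eq (i j : ι) : Relativizable (τ := τ) hm fun _ _ x _ => x i = x j :=
  fun _ _ _ _ => Definable.eq _ _

theorem forallFinite {κ : Type} [Finite κ] {P : κ → Pred τ m ι}
    (h : ∀ k, Relativizable hm (P k)) : Relativizable hm fun V N x W => ∀ k, P k V N x W :=
  fun _ _ c ρ => Definable.forallFinite fun k => h k _ c ρ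

theorem mem_univ (a : ι) : Relativizable (τ := τ) hm fun _ N x _ => x a ∈ N.univ :=
  fun _ _ c ρ => Definable.mem_stateAt_univ hm c (ρ a)

/-- Variables may be read from the context too, which provides values even if there are no
arguments, as for sentences. -/
theorem sat (φ : Formula τ m) (ρ : ℕ → Fin m ⊕ ι) :
    Relativizable hm fun _ N x W => φ.Sat N ⟨Sum.elim N.ctx x ∘ ρ, W⟩ := fun _ _ c ρ' => by
  refine (Definable.sat_stateAt hm φ c (Sum.elim c ρ' ∘ ρ)).congr fun V M x W _ _ => ?_
  have : Sum.elim (stateAt hm M W (x ∘ c)).ctx (x ∘ ρ') = x ∘ Sum.elim c ρ' :=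
    (Sum.comp_elim x c ρ').symm
  simp only [this]; rfl

theorem existsTuple {n : ℕ} {P : Pred τ m (ι ⊕ Fin n)} (h : Relativizable hm P) :
    Relativizable hm fun V N x W => ∃ y : Fin n → V, (∀ k, y k ∈ N.univ) ∧
      P V N (Sum.elim x y) W := fun κ _ c ρ => by
  refine (Definable.existsTuple (n := n) (((forallFinite fun k => mem_univ (Sum.inr k)).and h)
    _ (Sum.inl ∘ c) (Sum.map ρ id))).congr fun V M x W _ _ => exists_congr fun y => ?_
  have h1 : Sum.elim x y ∘ Sum.inl ∘ c = x ∘ c := rfl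
  have h2 : Sum.elim x y ∘ Sum.map ρ id = Sum.elim (x ∘ ρ) y := by
    rw [Sum.elim_comp_map]; rfl
  rw [h1, h2]
  exact ⟨fun ⟨hy, h⟩ => ⟨fun k => stateAt_univ_subset hm M W _ (hy k), hy, h⟩, fun h => h.2⟩

theorem forallTuple {n : ℕ} {P : Pred τ m (ι ⊕ Fin n)} (h : Relativizable hm P) :
    Relativizable hm fun V N x W => ∀ y : Fin n → V, (∀ k, y k ∈ N.univ) →
      P V N (Sum.elim x y) W :=
  h.not.existsTuple.not.congr fun _ _ _ _ => by simp

theorem univ_nonempty : Relativizable (τ := τ) (ι := ι) hm fun _ N _ _ => N.univ.Nonempty :=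
  (existsTuple (n := 1) (const True)).congr fun _ _ _ _ =>
    ⟨fun ⟨a, ha⟩ => ⟨fun _ => a, fun _ => ha, trivial⟩, fun ⟨y, hy, _⟩ => ⟨y 0, hy 0⟩⟩

theorem holds {n : ℕ} {φ : Formula τ m} (hφ : φ.FreeBelow n) (t : Fin n → ι) :
    Relativizable hm fun _ N x _ => (∀ j, x (t j) ∈ N.univ) → N.Holds φ (x ∘ t) := by
  -- Variables from v_n on receive the first context element, possibly not in `N.univ`, as a dummy
  -- value. On an empty universe `Holds` is vacuous, hence the premise `univ_nonempty`.
  refine ((forallFinite fun j => mem_univ (t j)).imp (univ_nonempty.imp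
    (sat φ fun i => if h : i < n then Sum.inr (t ⟨i, h⟩) else Sum.inl ⟨0, hm⟩))).congr
      fun V N x W => imp_congr_right fun ht => ?_
  by_cases hN : N.univ.Nonempty
  · rw [OrdGraph.holds_iff hφ (b := x ∘ t) ht hN (z := ⟨_, W⟩)]
    · exact ⟨fun h _ => h, fun h => h hN⟩
    · intro j; simp
  · simp only [hN, false_imp_iff, iff_true]
    exact fun z hz _ => (hN ⟨_, hz.1 0⟩).elim

theorem models {φ : Formula τ m} (hφ : φ.IsSentence) :
    Relativizable (ι := ι) hm fun _ N _ _ => N.Models φ := by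
  refine (univ_nonempty.imp (sat φ fun _ => Sum.inl ⟨0, hm⟩)).congr fun V N x W => ?_
  by_cases hN : N.univ.Nonempty
  · rw [OrdGraph.models_iff hφ hN]
    exact ⟨fun h _ => h, fun h => h hN⟩
  · simp only [hN, false_imp_iff, iff_true]
    exact fun z hz => (hN ⟨_, hz.1 0⟩).elim

theorem mem_star_univ (T : Scheme τ m) (a : ι) :
    Relativizable hm fun _ N x _ => x a ∈ (T.star N).univ := by
  refine ((mem_univ a).and (holds T.dom_free fun _ => a)).congr fun V N x W => ?_
  simp only [Scheme.star, Scheme.newUniv, Finset.mem_filter, forall_const]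
  exact and_congr_right fun h => ⟨fun h' _ => h', fun h' => h' h⟩

theorem _root_.SOL.Scheme.star_univ_subset {V : Type} (T : Scheme τ m) (N : OrdGraph τ m V) :
    (T.star N).univ ⊆ N.univ := by
  classical exact Finset.filter_subset _ _

theorem star_rel (T : Scheme τ m) (r : Fin τ.numRel) (t : Fin (τ.arity r) → ι) :
    Relativizable hm fun _ N x _ => (T.star N).rel r (x ∘ t) := by
  refine ((forallFinite fun j => mem_star_univ T (t j)).and (holds (T.rel_free r) t)).congr
    fun V N x W => and_congr_right fun h => ?_
  exact ⟨fun h' _ => h', fun h' => h' fun j => T.star_univ_subset N (h j)⟩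

theorem star_ord (T : Scheme τ m) (s t : Fin m → ι) :
    Relativizable hm fun _ N x _ => (T.star N).ord (x ∘ s) (x ∘ t) := by
  refine ((forallFinite fun j => (mem_star_univ T (s j)).and (mem_star_univ T (t j))).and
    (holds T.ord_free (Fin.append s t))).congr fun V N x W => and_congr_right fun h => ?_
  rw [comp_append]
  refine ⟨fun h' _ => h', fun h' => h' fun j => ?_⟩
  refine Fin.addCases (fun i => ?_) (fun i => ?_) j
  · rw [Fin.append_left]
    exact T.star_univ_subset N (h i).1
  · rw [Fin.append_right]
    exact T.star_univ_subset N (h i).2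

theorem isFirst_star (T : Scheme τ m) (t : Fin m → ι) :
    Relativizable hm fun _ N x _ => IsFirst (T.star N).univ (T.star N).ord (x ∘ t) := by
  have h : Relativizable hm fun V N (x : ι ⊕ Fin m → V) _ =>
      (∀ j, x (Sum.inr j) ∈ (T.star N).univ) → ¬ (∀ j, x (Sum.inr j) = x (Sum.inl (t j))) →
        (T.star N).ord (x ∘ Sum.inl ∘ t) (x ∘ Sum.inr) :=
    (forallFinite fun j => mem_star_univ T _).imp
      ((forallFinite fun j => eq _ _).not.imp (star_ord T _ _))
  refine ((forallFinite fun j => mem_star_univ T (t j)).and h.forallTuple).congr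
    fun V N x W => and_congr_right fun _ => forall_congr' fun y => ?_
  simp only [Sum.elim_inr, Sum.elim_inl, ne_eq, funext_iff]
  exact ⟨fun h _ h1 h2 => h h1 h2, fun h h1 h2 => h (fun k => T.star_univ_subset N (h1 k)) h1 h2⟩

end Relativizable

/-! ## Short polynomial expressions as sums of monomial expressions -/

universe u

variable {R : Type u} [CommSemiring R]

/-- `F` is the value of a monomial expression, uniformly, in all coded structures. -/
def MonoRelativizable (hm : 0 < m) (F : Fun τ m R ι) : Prop :=
  ∀ (κ : Type) [Finite κ] (c : Fin m → κ) (ρ : ι → κ), MonoDefinable fun V M (x : κ → V) W =>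
    F V (stateAt hm M W (x ∘ c)) (x ∘ ρ) fun U => W U.shift

theorem MonoRelativizable.reindex {hm : 0 < m} {κ : Type} {F : Fun τ m R κ}
    (h : MonoRelativizable hm F) (r : κ → ι) :
    MonoRelativizable hm fun V N (x : ι → V) W => F V N (x ∘ r) W := fun _ _ c ρ => h _ c (ρ ∘ r)

/-- The naming of variables that takes those in `a` as new arguments. -/
def overNaming (ρ : ℕ → ι) (a : Finset ℕ) (i : ℕ) : ι ⊕ a :=
  if h : i ∈ a then Sum.inr ⟨i, h⟩ else Sum.inl (ρ i)

theorem Assign.overInd_comp {V : Type} (x : ι → V) (ρ : ℕ → ι) (W : RelAssign V) (a : Finset ℕ)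
    (f : a → V) :
    Assign.overInd ⟨x ∘ ρ, W⟩ a f = ⟨Sum.elim x f ∘ overNaming ρ a, W⟩ := by
  simp only [Assign.overInd, Assign.mk.injEq, and_true]
  funext i
  by_cases h : i ∈ a <;> simp [overNaming, h]

theorem Relativizable.sat_comp (hm : 0 < m) (φ : Formula τ m) (ρ : ℕ → ι) :
    Relativizable hm fun _ N x W => φ.Sat N ⟨x ∘ ρ, W⟩ :=
  Relativizable.sat φ (Sum.inr ∘ ρ)

theorem mem_piFinset_const {α V : Type} {_ : Fintype α} {_ : DecidableEq α} {A : Finset V}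
    {f : α → V} : f ∈ Fintype.piFinset (fun _ : α => A) ↔ ∀ i, f i ∈ A :=
  Fintype.mem_piFinset

theorem mem_filter_of_decidable {α : Type} {p : α → Prop} {_ : DecidablePred p} {s : Finset α}
    {a : α} : a ∈ s.filter p ↔ a ∈ s ∧ p a :=
  Finset.mem_filter

-- A product over the coded universe becomes a product over A with membership in the code added to
-- its condition.
open Classical in
theorem MonoExpr.relativizable (hm : 0 < m) (t : MonoExpr τ m R) (ρ : ℕ → ι) :
    MonoRelativizable hm fun _ N x W => t.eval N ⟨x ∘ ρ, W⟩ := by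
  induction t generalizing ι with
  | const a => exact fun _ _ _ _ => MonoDefinable.const a
  | tv φ => exact fun _ _ c ρ' => MonoDefinable.tv (Relativizable.sat_comp hm φ ρ _ c ρ')
  | prod n t ih => exact fun _ _ c ρ' => MonoDefinable.prod fun j => ih j ρ _ c ρ'
  | bprod a φ t ih =>
    intro κ _ c ρ'
    have hP := ((Relativizable.forallFinite fun k : a => Relativizable.mem_univ (Sum.inr k)).and
      (Relativizable.sat_comp hm φ (overNaming ρ a))) _ (Sum.inl ∘ c) (Sum.map ρ' id)
    have hF := ih (overNaming ρ a) _ (Sum.inl ∘ c) (Sum.map ρ' id)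
    refine (MonoDefinable.bprod hP hF).congr fun V M x W hx hW => ?_
    have h1 (y : a → V) : Sum.elim x y ∘ Sum.inl ∘ c = x ∘ c := rfl
    have h2 (y : a → V) : Sum.elim x y ∘ Sum.map ρ' id = Sum.elim (x ∘ ρ') y := by
      rw [Sum.elim_comp_map]; rfl
    simp only [MonoExpr.eval, h1, h2, Assign.overInd_comp]
    refine Finset.prod_congr ?_ fun _ _ => rfl
    ext y
    rw [Finset.mem_filter, Finset.mem_filter, mem_piFinset_const, mem_piFinset_const]
    exact ⟨fun h => ⟨fun k => stateAt_univ_subset hm M W _ (h.1 k), h⟩, fun h => h.2⟩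

theorem sum_piFinset_sum {V α β : Type} {_ : Fintype α} {_ : Fintype β} {_ : Fintype (α ⊕ β)}
    {_ : DecidableEq α} {_ : DecidableEq β} {_ : DecidableEq (α ⊕ β)}
    (A : Finset V) (G : (α ⊕ β → V) → R) :
    ∑ w ∈ Fintype.piFinset (fun _ : α ⊕ β => A), G w =
      ∑ f ∈ Fintype.piFinset (fun _ : α => A), ∑ y ∈ Fintype.piFinset (fun _ : β => A),
        G (Sum.elim f y) := by
  rw [← Finset.sum_product']
  refine Finset.sum_equiv (Equiv.sumArrowEquivProdArrow α β V) (fun w => ?_) (fun w _ => ?_)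
  · simp [Fintype.mem_piFinset, Equiv.sumArrowEquivProdArrow]
  · congr 1
    exact (Sum.elim_comp_inl_inr w).symm

-- Sums are moved outward. Nested bounded sums merge into one over the disjoint union of their
-- variables, under the conjunction of their conditions; finite sums merge by a disjoint union of
-- index sets; a monomial is a sum over the empty tuple.
open Classical in
theorem PolyExpr.IsShort.exists_sum (hm : 0 < m) {S : PolyExpr τ m R} (hS : S.IsShort)
    (ρ : ℕ → ι) :
    ∃ (K : Type) (_ : Fintype K) (κ : K → Type) (_ : ∀ k, Fintype (κ k))
      (P : ∀ k, Pred τ m (ι ⊕ κ k)) (F : ∀ k, Fun τ m R (ι ⊕ κ k)),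
      (∀ k, Relativizable hm (P k)) ∧ (∀ k, MonoRelativizable hm (F k)) ∧
      ∀ V (N : OrdGraph τ m V) (x : ι → V) (W : RelAssign V), S.eval N ⟨x ∘ ρ, W⟩ =
        ∑ k, ∑ y ∈ (Fintype.piFinset fun _ : κ k => N.univ) with P k V N (Sum.elim x y) W,
          F k V N (Sum.elim x y) W := by
  induction S generalizing ι with
  | mono t =>
    refine ⟨Unit, inferInstance, fun _ => Empty, inferInstance, fun _ _ _ _ _ => True,
      fun _ _ N x W => t.eval N ⟨x ∘ Sum.inl ∘ ρ, W⟩, fun _ => Relativizable.const True,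
      fun _ => t.relativizable hm (Sum.inl ∘ ρ), fun V N x W => ?_⟩
    simp only [PolyExpr.eval, Finset.univ_unique, Finset.sum_singleton, Finset.filter_true]
    symm
    exact Finset.sum_eq_single_of_mem (fun e : Empty => e.elim)
      (mem_piFinset_const.2 fun e => e.elim) fun y _ h => (h (Subsingleton.elim _ _)).elim
  | sum n t ih =>
    choose K _ κ _ P F hP hF h using fun j => ih j (hS j) ρ
    refine ⟨Σ j, K j, inferInstance, fun k => κ k.1 k.2, inferInstance, fun k => P k.1 k.2,
      fun k => F k.1 k.2, fun k => hP k.1 k.2, fun k => hF k.1 k.2, fun V N x W => ?_⟩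
    simp only [PolyExpr.eval, h, Fintype.sum_sigma]
  | bsum a φ t ih =>
    obtain ⟨K, _, κ, _, P, F, hP, hF, h⟩ := ih hS (overNaming ρ a)
    let r (k : K) : (ι ⊕ a) ⊕ κ k → ι ⊕ (a ⊕ κ k) := Equiv.sumAssoc _ _ _
    have hr {V : Type} (k : K) (x : ι → V) (f : a → V) (y : κ k → V) :
        Sum.elim x (Sum.elim f y) ∘ r k = Sum.elim (Sum.elim x f) y := by
      funext j; rcases j with (j | j) | j <;> rfl
    refine ⟨K, inferInstance, fun k => a ⊕ κ k, inferInstance,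
      fun k V N x W => φ.Sat N ⟨(x ∘ r k ∘ Sum.inl) ∘ overNaming ρ a, W⟩ ∧ P k V N (x ∘ r k) W,
      fun k V N x W => F k V N (x ∘ r k) W,
      fun k => ((Relativizable.sat_comp hm φ (overNaming ρ a)).reindex _).and ((hP k).reindex _),
      fun k => (hF k).reindex _, fun V N x W => ?_⟩
    simp only [PolyExpr.eval, Assign.overInd_comp, h]
    simp only [Finset.sum_filter]
    simp only [sum_piFinset_sum]
    rw [Finset.sum_comm]
    refine Finset.sum_congr rfl fun f _ => ?_
    have h1 (k : K) (y : κ k → V) :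
        Sum.elim x (Sum.elim f y) ∘ r k ∘ Sum.inl = Sum.elim x f := by
      funext j; rcases j with j | j <;> rfl
    simp only [hr, h1]
    by_cases hφ : φ.Sat N ⟨Sum.elim x f ∘ overNaming ρ a, W⟩ <;> simp [hφ]
  | lsum W φ t ih => exact hS.elim

open Classical in
/-- The values of a short expression are sums of values of monomials, over tuples. -/
theorem PolyExpr.IsShort.exists_sum_tuples (hm : 0 < m) {S : PolyExpr τ m R} (hS : S.IsShort)
    (ρ : ℕ → ι) :
    ∃ (K : Type) (_ : Fintype K) (n : K → ℕ)
      (P : ∀ k, Pred τ m (ι ⊕ Fin (n k))) (F : ∀ k, Fun τ m R (ι ⊕ Fin (n k))),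
      (∀ k, Relativizable hm (P k)) ∧ (∀ k, MonoRelativizable hm (F k)) ∧
      ∀ V (N : OrdGraph τ m V) (x : ι → V) (W : RelAssign V), S.eval N ⟨x ∘ ρ, W⟩ =
        ∑ k, ∑ y ∈ (N.tuples (n k)) with P k V N (Sum.elim x y) W,
          F k V N (Sum.elim x y) W := by
  obtain ⟨K, _, κ, _, P, F, hP, hF, h⟩ := hS.exists_sum hm ρ
  let E (k : K) : κ k ≃ Fin (Fintype.card (κ k)) := Fintype.equivFin _
  refine ⟨K, inferInstance, fun k => Fintype.card (κ k),
    fun k V N x W => P k V N (x ∘ Sum.map id (E k)) W,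
    fun k V N x W => F k V N (x ∘ Sum.map id (E k)) W,
    fun k => (hP k).reindex _, fun k => (hF k).reindex _, fun V N x W => ?_⟩
  rw [h]
  refine Finset.sum_congr rfl fun k _ => ?_
  symm
  refine Finset.sum_equiv ((E k).symm.arrowCongr (Equiv.refl V)) (fun y => ?_) (fun y _ => ?_)
  · have : (E k).symm.arrowCongr (Equiv.refl V) y = y ∘ E k := by
      funext i; simp [Equiv.arrowCongr]
    simp only []
    rw [this, Finset.mem_filter, Finset.mem_filter, Sum.elim_comp_map, Graph.mem_tuples,
      Fintype.mem_piFinset, Function.comp_id]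
    refine and_congr_left fun _ => ⟨fun h j => h _, fun h j => ?_⟩
    simpa using h ((E k).symm j)
  · have : (E k).symm.arrowCongr (Equiv.refl V) y = y ∘ E k := by
      funext i; simp [Equiv.arrowCongr]
    simp only []
    rw [this, Sum.elim_comp_map, Function.comp_id]

end SOL

/-! ### An abstract recursion for sums over labellings of a finite strict order. -/

namespace SOL

/-! ## Sums over runs -/

universe u

/-- A system in which a label at a position determines the next positions, and which labels may
occur there. -/
structure LabelSystem (X L : Type) where
  lt : X → X → Prop
  blank : L
  next : X → L → X → Prop
  fits : X → L → X → L → Prop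

namespace LabelSystem

variable {X L : Type} (A : LabelSystem X L)

/-- A labelling is a run from the positions in `start`, at which the labels have to satisfy `ok`, if
the positions with a label are those reached from there, along steps which increase the position and
obey the rules for labels. -/
structure IsRun (start : X → Prop) (ok : X → L → Prop) (g : X → L) : Prop where
  root : ∀ y, start y → ok y (g y)
  step : ∀ y, g y ≠ A.blank → ∀ y', A.next y (g y) y' → A.lt y y' ∧ A.fits y (g y) y' (g y')
  reach : ∀ y, g y ≠ A.blank → start y ∨ ∃ y₀, g y₀ ≠ A.blank ∧ A.next y₀ (g y₀) y

variable {A}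

/-- Going back by `reach` lowers the position, and well-foundedness ends the search at a start. So a
run has no labels other than those its start leads to. -/
theorem IsRun.exists_start [Finite X] [IsStrictOrder X A.lt] {start : X → Prop}
    {ok : X → L → Prop} {g : X → L} (h : A.IsRun start ok g) {y : X} (hy : g y ≠ A.blank) :
    ∃ x, start x ∧ (x = y ∨ A.lt x y) := by
  induction y using (Finite.wellFounded_of_trans_of_irrefl A.lt).induction with
  | _ y ih =>
    rcases h.reach y hy with h' | ⟨y₀, hy₀, hn⟩
    · exact ⟨y, h', Or.inl rfl⟩
    · have hlt := (h.step y₀ hy₀ y hn).1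
      obtain ⟨x, hx, hxy⟩ := ih y₀ hlt hy₀
      refine ⟨x, hx, Or.inr ?_⟩
      rcases hxy with rfl | hxy
      · exact hlt
      · exact _root_.trans hxy hlt

theorem isRun_iff_of_isEmpty [Finite X] [IsStrictOrder X A.lt] {start : X → Prop}
    {ok : X → L → Prop} (hs : ∀ y, ¬ start y) (g : X → L) :
    A.IsRun start ok g ↔ g = fun _ => A.blank := by
  constructor
  · intro h
    funext y
    by_contra hy
    obtain ⟨x, hx, -⟩ := h.exists_start hy
    exact hs x hx
  · rintro rfl
    exact ⟨fun y hy => (hs y hy).elim, fun y hy => (hy rfl).elim, fun y hy => (hy rfl).elim⟩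

open Function

/-- Every labelled position is `y` or above `y`, so no step leads back to `y` and its label can be
erased without affecting later ones. -/
theorem IsRun.tail [DecidableEq X] [Finite X] [IsStrictOrder X A.lt] {start : X → Prop}
    {ok : X → L → Prop} {y : X} (hs : ∀ x, start x ↔ x = y) {g : X → L} (h : A.IsRun start ok g)
    (hok : ∀ s, ok y s → s ≠ A.blank) :
    A.IsRun (A.next y (g y)) (A.fits y (g y)) (update g y A.blank) := by
  have hy : g y ≠ A.blank := hok _ (h.root y ((hs y).2 rfl))
  have hlt : ∀ x, g x ≠ A.blank → x = y ∨ A.lt y x := fun x hx => by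
    obtain ⟨z, hz, hzx⟩ := h.exists_start hx
    obtain rfl := (hs z).1 hz
    exact hzx.imp_left Eq.symm
  have irr : ∀ x, ¬ A.lt x x := irrefl_of A.lt
  constructor
  · intro y' hn
    obtain ⟨h1, h2⟩ := h.step y hy y' hn
    rw [update_of_ne]
    · exact h2
    · rintro rfl; exact irr _ h1
  · intro x hx y' hn
    have hxy : x ≠ y := by rintro rfl; simp at hx
    rw [update_of_ne hxy] at hx hn ⊢
    obtain ⟨h1, h2⟩ := h.step x hx y' hn
    refine ⟨h1, ?_⟩
    rw [update_of_ne]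
    · exact h2
    · rintro rfl
      rcases hlt x hx with h' | h'
      · exact hxy h'
      · exact irr _ (_root_.trans h1 h')
  · intro x hx
    have hxy : x ≠ y := by rintro rfl; simp at hx
    rw [update_of_ne hxy] at hx
    rcases h.reach x hx with h' | ⟨y₀, hy₀, hn⟩
    · exact (hxy ((hs x).1 h')).elim
    · by_cases hy₀y : y₀ = y
      · subst hy₀y; exact Or.inl hn
      · exact Or.inr ⟨y₀, by rwa [update_of_ne hy₀y], by rwa [update_of_ne hy₀y]⟩

theorem IsRun.eq_blank [Finite X] [IsStrictOrder X A.lt] {y : X} {s : L}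
    (hlt : ∀ y', A.next y s y' → A.lt y y') {ok : X → L → Prop} {g : X → L}
    (h : A.IsRun (A.next y s) ok g) : g y = A.blank := by
  by_contra hy
  obtain ⟨z, hz, hzx⟩ := h.exists_start hy
  have irr : ∀ x, ¬ A.lt x x := irrefl_of A.lt
  rcases hzx with rfl | hzx
  · exact irr _ (hlt _ hz)
  · exact irr _ (_root_.trans hzx (hlt _ hz))

theorem IsRun.cons [DecidableEq X] [Finite X] [IsStrictOrder X A.lt] {start : X → Prop}
    {ok : X → L → Prop} {y : X} (hs : ∀ x, start x ↔ x = y) {s : L} (hok : ok y s)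
    (hne : s ≠ A.blank) (hlt : ∀ y', A.next y s y' → A.lt y y') {g : X → L}
    (h : A.IsRun (A.next y s) (A.fits y s) g) : A.IsRun start ok (update g y s) := by
  have irr : ∀ x, ¬ A.lt x x := irrefl_of A.lt
  have hgy := h.eq_blank hlt
  have hgt : ∀ x, g x ≠ A.blank → A.lt y x := fun x hx => by
    obtain ⟨z, hz, hzx⟩ := h.exists_start hx
    rcases hzx with rfl | hzx
    · exact hlt _ hz
    · exact _root_.trans (hlt _ hz) hzx
  constructor
  · intro x hx
    obtain rfl := (hs x).1 hx
    rwa [update_self]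
  · intro x hx y' hn
    by_cases hxy : x = y
    · subst hxy
      rw [update_self] at hn ⊢
      have := hlt _ hn
      refine ⟨this, ?_⟩
      rw [update_of_ne]
      · exact h.root _ hn
      · rintro rfl; exact irr _ this
    · rw [update_of_ne hxy] at hx hn ⊢
      obtain ⟨h1, h2⟩ := h.step x hx y' hn
      refine ⟨h1, ?_⟩
      rw [update_of_ne]
      · exact h2
      · rintro rfl; exact irr _ (_root_.trans h1 (hgt x hx))
  · intro x hx
    by_cases hxy : x = y
    · exact Or.inl ((hs x).2 hxy)
    · rw [update_of_ne hxy] at hx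
      refine Or.inr ?_
      rcases h.reach x hx with h' | ⟨y₀, hy₀, hn⟩
      · exact ⟨y, by rwa [update_self], by rwa [update_self]⟩
      · have : y₀ ≠ y := by rintro rfl; exact hy₀ hgy
        exact ⟨y₀, by rwa [update_of_ne this], by rwa [update_of_ne this]⟩

variable {R : Type u} [CommSemiring R] [Fintype X] [Fintype L]

variable (A) in
open Classical in
/-- The sum of the weights of all runs. -/
noncomputable def runSum (w : X → L → R) (start : X → Prop) (ok : X → L → Prop) : R :=
  ∑ g : X → L with A.IsRun start ok g, ∏ y, w y (g y)

/-- Only the blank labelling is a run; its weight 1 is the value of a leaf. -/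
theorem runSum_of_isEmpty [IsStrictOrder X A.lt] {w : X → L → R} (hw : ∀ y, w y A.blank = 1)
    {start : X → Prop} (ok : X → L → Prop) (hs : ∀ y, ¬ start y) : A.runSum w start ok = 1 := by
  classical
  rw [runSum, Finset.sum_filter, Fintype.sum_eq_single fun _ => A.blank]
  · simp [isRun_iff_of_isEmpty hs, hw]
  · intro g hg
    simp [isRun_iff_of_isEmpty hs, hg]

-- By `IsRun.tail` and `IsRun.cons`, separating the label at `y` from the rest is a bijection;
-- `IsRun.eq_blank` shows that nothing at `y` is overwritten on the way back. The factor at `y`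
-- splits off because blank labels weigh 1.
open Classical in
theorem runSum_eq_sum [IsStrictOrder X A.lt] {w : X → L → R} (hw : ∀ y, w y A.blank = 1)
    {start : X → Prop} {ok : X → L → Prop} {y : X} (hs : ∀ x, start x ↔ x = y)
    (hok : ∀ s, ok y s → s ≠ A.blank ∧ ∀ y', A.next y s y' → A.lt y y') :
    A.runSum w start ok =
      ∑ s with ok y s, w y s * A.runSum w (A.next y s) (A.fits y s) := by
  simp only [runSum, Finset.mul_sum]
  rw [Finset.sum_sigma']
  refine Finset.sum_bij' (fun g _ => ⟨g y, update g y A.blank⟩) (fun p _ => update p.2 y p.1)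
    ?_ ?_ ?_ ?_ ?_
  · intro g hg
    have hg := (Finset.mem_filter.1 hg).2
    simp only [Finset.mem_sigma, Finset.mem_filter, Finset.mem_univ, true_and]
    exact ⟨hg.root y ((hs y).2 rfl), hg.tail hs fun s h => (hok s h).1⟩
  · rintro ⟨s, g⟩ hg
    simp only [Finset.mem_sigma, Finset.mem_filter, Finset.mem_univ, true_and] at hg ⊢
    exact hg.2.cons hs hg.1 (hok s hg.1).1 (hok s hg.1).2
  · intro g _
    simp
  · rintro ⟨s, g⟩ hg
    simp only [Finset.mem_sigma, Finset.mem_filter, Finset.mem_univ, true_and] at hg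
    have := hg.2.eq_blank (hok s hg.1).2
    simp [← this]
  · intro g _
    rw [← Finset.mul_prod_erase Finset.univ (fun x => w x (g x)) (Finset.mem_univ y),
      ← Finset.mul_prod_erase Finset.univ (fun x => w x (update g y A.blank x))
        (Finset.mem_univ y), update_self, hw, one_mul]
    congr 1
    refine Finset.prod_congr rfl fun x hx => ?_
    rw [update_of_ne (Finset.ne_of_mem_erase hx)]

end LabelSystem

end SOL

/-! ### Runs of a recursive definition, coded by relations, and their definability. -/

namespace SOL

universe u

variable {τ : Vocabulary} {m ℓ : ℕ} {R : Type u} [CommSemiring R]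

/-! ## Runs of a recursive definition -/

open Classical in
/-- Representations of the coefficients of a recursive definition as sums, over tuples, of values of
monomial expressions. -/
structure Steps (hm : 0 < m) (D : RecDef τ m ℓ R) where
  Branch : Fin ℓ → Type
  fintype : ∀ i, Fintype (Branch i)
  len : (Σ i, Branch i) → ℕ
  cond : ∀ p, Pred τ m (Fin m ⊕ Fin (len p))
  term : ∀ p, Fun τ m R (Fin m ⊕ Fin (len p))
  cond_rel : ∀ p, Relativizable hm (cond p)
  term_rel : ∀ p, MonoRelativizable hm (term p)
  coeff_eval : ∀ i V (N : OrdGraph τ m V) z W, (D.coeff i).eval N z =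
    ∑ k : Branch i, ∑ y ∈ (N.tuples (len ⟨i, k⟩)) with cond ⟨i, k⟩ V N (Sum.elim N.ctx y) W,
      term ⟨i, k⟩ V N (Sum.elim N.ctx y) W

theorem nonempty_steps (hm : 0 < m) {D : RecDef τ m ℓ R} (hs : ∀ i, (D.coeff i).IsShort)
    (hc : ∀ i, (D.coeff i).free = ∅) : Nonempty (Steps hm D) := by
  -- Coefficients have no free variables, so every name may denote the first context element.
  choose B hB n P F hP hF h using fun i => (hs i).exists_sum_tuples hm (fun _ => (⟨0, hm⟩ : Fin m))
  refine ⟨⟨B, hB, fun p => n p.1 p.2, fun p => P p.1 p.2, fun p => F p.1 p.2,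
    fun p => hP p.1 p.2, fun p => hF p.1 p.2, fun i V N z W => ?_⟩⟩
  rw [← h i V N N.ctx W]
  exact PolyExpr.eval_congr N (by rw [hc i]; exact Assign.AgreeOn.empty)

attribute [instance] Steps.fintype

namespace Steps

variable {hm : 0 < m} {D : RecDef τ m ℓ R} (B : Steps hm D)

/-- A branch of a coefficient, which determines the transformation that is applied. -/
abbrev Step : Type := Σ i, B.Branch i

/-- The relations that make up a label: those that code a graph, and for each step the set of
tuples chosen for it. -/
abbrev Part : Type := Option (Fin τ.numRel) ⊕ B.Step

abbrev arity : B.Part → ℕ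
  | .inl q => codeArity τ q
  | .inr p => B.len p

/-- The numbers up to `τ.numRel` are taken by `codeIdx`; the steps follow. -/
noncomputable def num : B.Part → ℕ
  | .inl q => codeIdx τ q
  | .inr p => τ.numRel + 1 + Fintype.equivFin B.Step p

theorem num_injective : Function.Injective B.num := by
  rintro ((_ | r) | p) ((_ | r') | p') h <;> simp only [num, codeIdx] at h
  · rfl
  · omega
  · omega
  · omega
  · rw [Fin.ext (by omega : (r : ℕ) = r')]
  · omega
  · omega
  · omega
  · exact congrArg Sum.inr ((Fintype.equivFin B.Step).injective (Fin.ext (by omega)))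

/-- The relation variable for a family of relations. -/
noncomputable abbrev var (q : B.Part) : RelVar := auxVar hm (B.arity q) (B.num q)

theorem var_injective : Function.Injective B.var := fun q q' h => by
  have := congrArg RelVar.idx h
  exact B.num_injective (by simpa using this)

/-- A label: a code of a graph and a step. -/
abbrev RawLabel (V : Type) : Type := ∀ q, Finset (Fin (B.arity q) → V)

variable {V : Type}

/-- The graph coded by a label. -/
noncomputable abbrev graphOf (M : OrdGraph τ m V) (y : Fin m → V) (s : B.RawLabel V) :
    OrdGraph τ m V :=
  coded M y fun q => s (Sum.inl q)

/-- The label given by an interpretation of the relation variables. -/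
noncomputable abbrev labelAt (M : OrdGraph τ m V) (W : RelAssign V) (y : Fin m → V) :
    B.RawLabel V :=
  fun q => slice hm M W y (B.arity q) (B.num q)

/-- The label `s` codes the graph `N`. -/
def Codes (N : Graph τ V) (s : B.RawLabel V) : Prop :=
  (∀ t : Fin 1 → V, t ∈ s (Sum.inl none) ↔ t 0 ∈ N.univ) ∧
    ∀ (r : Fin τ.numRel) (t : Fin (τ.arity r) → V), t ∈ s (Sum.inl (some r)) ↔ N.rel r t

/-- The tuple `a` may be chosen for the step `p` in `N`. -/
def Choice (N : OrdGraph τ m V) (W : RelAssign V) (p : B.Step) (a : Fin (B.len p) → V) : Prop :=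
  (∀ j, a j ∈ N.univ) ∧ N.Models (D.guard p.1) ∧ B.cond p V N (Sum.elim N.ctx a) W

/-- The label `s` contains the step `p` with the tuple `a`, and nothing else. -/
def Picks (s : B.RawLabel V) (p : B.Step) (a : Fin (B.len p) → V) : Prop :=
  a ∈ s (Sum.inr p) ∧ ∀ p' a', a' ∈ s (Sum.inr p') →
    (⟨p', a'⟩ : Σ p, Fin (B.len p) → V) = ⟨p, a⟩

/-- The label `s` contains a possible step. -/
def Ok (M : OrdGraph τ m V) (W : RelAssign V) (y : Fin m → V) (s : B.RawLabel V) : Prop :=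
  ∃ p a, B.Picks s p a ∧ B.Choice (B.graphOf M y s) W p a

/-- `y'` is the context after the step. -/
def Next (M : OrdGraph τ m V) (y : Fin m → V) (s : B.RawLabel V) (y' : Fin m → V) : Prop :=
  ∃ p : B.Step, (∃ a, a ∈ s (Sum.inr p)) ∧ IsFirst ((D.scheme p.1).star (B.graphOf M y s)).univ
    ((D.scheme p.1).star (B.graphOf M y s)).ord y'

/-- `s'` is a possible label at `y'` after the step. -/
def Fits (M : OrdGraph τ m V) (W : RelAssign V) (y : Fin m → V) (s : B.RawLabel V) (y' : Fin m → V)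
    (s' : B.RawLabel V) : Prop :=
  (∃ p : B.Step, (∃ a, a ∈ s (Sum.inr p)) ∧
    B.Codes ((D.scheme p.1).star (B.graphOf M y s)).toGraph s') ∧ B.Ok M W y' s'

/-- The label `s` is not empty. -/
def Marked (s : B.RawLabel V) : Prop := ∃ q t, t ∈ s q

/-- The relations in `W` describe a run on `M`. -/
def RunOn (M : OrdGraph τ m V) (W : RelAssign V) : Prop :=
  (∀ y : Fin m → V, (∀ j, y j ∈ M.univ) → IsFirst M.univ M.ord y →
    B.Codes M.toGraph (B.labelAt M W y) ∧ B.Ok M (fun U => W U.shift) y (B.labelAt M W y)) ∧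
  (∀ y : Fin m → V, (∀ j, y j ∈ M.univ) → B.Marked (B.labelAt M W y) →
    ∀ y' : Fin m → V, (∀ j, y' j ∈ M.univ) → B.Next M y (B.labelAt M W y) y' →
      M.ord y y' ∧
        B.Fits M (fun U => W U.shift) y (B.labelAt M W y) y' (B.labelAt M W y')) ∧
  ∀ y : Fin m → V, (∀ j, y j ∈ M.univ) → B.Marked (B.labelAt M W y) → IsFirst M.univ M.ord y ∨
    ∃ y₀ : Fin m → V, (∀ j, y₀ j ∈ M.univ) ∧ B.Marked (B.labelAt M W y₀) ∧
      B.Next M y₀ (B.labelAt M W y₀) y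

/-! ### Definability of runs -/

section Definability

variable {ι : Type} [Finite ι]

theorem mem_univ_of_mem_slice {M : OrdGraph τ m V} {W : RelAssign V} {y : Fin m → V} {k i : ℕ}
    {t : Fin k → V} (h : t ∈ slice hm M W y k i) : ∀ j, t j ∈ M.univ := by
  classical exact Graph.mem_tuples.1 (Finset.mem_filter.1 h).1

theorem definable_exists_mem (c : Fin m → ι) (q : B.Part) :
    Definable fun _ M (x : ι → _) W => ∃ t, t ∈ B.labelAt M W (x ∘ c) q := by
  refine (Definable.existsTuple
    (Definable.mem_slice hm (Sum.inl ∘ c) (B.num q) (Sum.inr : Fin (B.arity q) → _))).congr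
      fun V M x W _ _ => exists_congr fun t => ?_
  exact ⟨fun h => ⟨mem_univ_of_mem_slice h, h⟩, fun h => h.2⟩

theorem definable_marked (c : Fin m → ι) :
    Definable fun _ M (x : ι → _) W => B.Marked (B.labelAt M W (x ∘ c)) :=
  Definable.existsFinite fun q => B.definable_exists_mem c q

theorem definable_picks (p : B.Step) (c : Fin m → ι) (a : Fin (B.len p) → ι) :
    Definable fun _ M (x : ι → _) W => B.Picks (B.labelAt M W (x ∘ c)) p (x ∘ a) := by
  refine (Definable.mem_slice hm c (B.num (Sum.inr p)) a).and ?_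
  refine Definable.forallFinite fun p' => ?_
  -- Steps are not elements of the structure: whether `p' = p` is decided outside the formula, and
  -- only the tuples are compared inside.
  have heq : Definable (τ := τ) (m := m) fun V _ (x : ι ⊕ Fin (B.len p') → V) _ =>
      (⟨p', x ∘ Sum.inr⟩ : Σ p, Fin (B.len p) → V) = ⟨p, x ∘ Sum.inl ∘ a⟩ := by
    by_cases h : p' = p
    · subst h
      refine (Definable.forallFinite fun j => Definable.eq (Sum.inr j) (Sum.inl (a j))).congr
        fun V M x W _ _ => ?_
      simp [funext_iff]
    · refine (Definable.const False).congr fun V M x W _ _ => ?_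
      simp [h]
  refine (((Definable.mem_slice hm (Sum.inl ∘ c) (B.num (Sum.inr p')) Sum.inr).imp
    heq).forallTuple).congr fun V M x W _ _ => forall_congr' fun a' => ?_
  exact ⟨fun h _ => h, fun h h' => h (mem_univ_of_mem_slice h') h'⟩

theorem definable_ok (hg : ∀ i, (D.guard i).IsSentence) (c : Fin m → ι) :
    Definable fun _ M (x : ι → _) W =>
      B.Ok M (fun U => W U.shift) (x ∘ c) (B.labelAt M W (x ∘ c)) := by
  refine Definable.existsFinite fun p => ?_
  have h1 := B.definable_picks p (ι := ι ⊕ Fin (B.len p)) (Sum.inl ∘ c) Sum.inr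
  have h2 : Definable fun _ M (x : ι ⊕ Fin (B.len p) → _) W =>
      B.Choice (stateAt hm M W (x ∘ Sum.inl ∘ c)) (fun U => W U.shift) p (x ∘ Sum.inr) := by
    refine (Definable.forallFinite fun j => Definable.mem_stateAt_univ hm _ (Sum.inr j)).and
      ((Relativizable.models (ι := Empty) (hg p.1) _ (Sum.inl ∘ c) Empty.elim).and ?_)
    refine (B.cond_rel p _ (Sum.inl ∘ c) (Sum.elim (Sum.inl ∘ c) Sum.inr)).congr
      fun V M x W _ _ => ?_
    rw [Sum.comp_elim]; rfl
  refine (h1.and h2).existsTuple.congr fun V M x W _ _ => exists_congr fun a => ?_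
  exact ⟨fun h => ⟨mem_univ_of_mem_slice h.1.1, h⟩, fun h => h.2⟩

theorem definable_next (c c' : Fin m → ι) :
    Definable fun _ M (x : ι → _) W => B.Next M (x ∘ c) (B.labelAt M W (x ∘ c)) (x ∘ c') :=
  Definable.existsFinite fun p => (B.definable_exists_mem c (Sum.inr p)).and
    (Relativizable.isFirst_star (D.scheme p.1) id _ c c')

/-- `Codes` concerns all tuples over `V`, a formula only those over `M.univ`. Outside `M.univ` both
sides of each equivalence fail, by `hN`. -/
theorem definable_codes {N : ∀ V, OrdGraph τ m V → (ι → V) → RelAssign V → Graph τ V}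
    (hN : ∀ V M x W, (N V M x W).univ ⊆ M.univ)
    (hu : Definable fun V M (x : ι ⊕ Fin 1 → V) W => x (Sum.inr 0) ∈ (N V M (x ∘ Sum.inl) W).univ)
    (hr : ∀ r, Definable fun V M (x : ι ⊕ Fin (τ.arity r) → V) W =>
      (N V M (x ∘ Sum.inl) W).rel r (x ∘ Sum.inr)) (c : Fin m → ι) :
    Definable fun V M x W => B.Codes (N V M x W) (B.labelAt M W (x ∘ c)) := by
  refine (((Definable.mem_slice hm (Sum.inl ∘ c) (B.num (Sum.inl none))
    (Sum.inr : Fin 1 → _)).iff hu).forallTuple.and (Definable.forallFinite fun r =>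
      ((Definable.mem_slice hm (Sum.inl ∘ c) (B.num (Sum.inl (some r)))
        (Sum.inr : Fin (τ.arity r) → _)).iff (hr r)).forallTuple)).congr
    fun V M x W _ _ => and_congr (forall_congr' fun t => ?_)
      (forall_congr' fun r => forall_congr' fun t => ?_)
  · refine ⟨fun h _ => h, fun h => ⟨fun h' => (h (mem_univ_of_mem_slice h')).1 h', fun h' => ?_⟩⟩
    refine (h fun k => ?_).2 h'
    rw [Subsingleton.elim k 0]
    exact hN _ _ _ _ h'
  · refine ⟨fun h _ => h, fun h => ⟨fun h' => (h (mem_univ_of_mem_slice h')).1 h', fun h' => ?_⟩⟩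
    exact (h fun k => hN _ _ _ _ ((N V M x W).rel_mem r t h' k)).2 h'

theorem definable_fits (hg : ∀ i, (D.guard i).IsSentence) (c c' : Fin m → ι) :
    Definable fun _ M (x : ι → _) W =>
      B.Fits M (fun U => W U.shift) (x ∘ c) (B.labelAt M W (x ∘ c)) (x ∘ c')
        (B.labelAt M W (x ∘ c')) := by
  refine (Definable.existsFinite fun p => (B.definable_exists_mem c (Sum.inr p)).and ?_).and
    (B.definable_ok hg c')
  refine B.definable_codes (N := fun V M x W =>
    ((D.scheme p.1).star (stateAt hm M W (x ∘ c))).toGraph) (fun V M x W => ?_) ?_ (fun r => ?_) c'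
  · exact ((D.scheme p.1).star_univ_subset _).trans (stateAt_univ_subset hm M W _)
  · exact Relativizable.mem_star_univ (D.scheme p.1) (0 : Fin 1) _ (Sum.inl ∘ c) Sum.inr
  · exact Relativizable.star_rel (D.scheme p.1) r id _ (Sum.inl ∘ c) Sum.inr

theorem definable_isFirst (c : Fin m → ι) :
    Definable (τ := τ) fun _ M (x : ι → _) _ => IsFirst M.univ M.ord (x ∘ c) := by
  have h : Definable (τ := τ) fun _ M (x : ι ⊕ Fin m → _) _ =>
      ¬ (∀ j, x (Sum.inr j) = x (Sum.inl (c j))) → M.ord (x ∘ Sum.inl ∘ c) (x ∘ Sum.inr) :=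
    (Definable.forallFinite fun j => Definable.eq _ _).not.imp (Definable.ord _ _)
  refine h.forallTuple.congr fun V M x W hx _ => ?_
  simp only [IsFirst, Function.comp_apply, hx, implies_true, true_and, Sum.elim_inr, Sum.elim_inl,
    ne_eq, funext_iff]
  rfl

/-- This provides the condition of the long sum; it has no individual arguments, only relations. -/
theorem definable_runOn (hg : ∀ i, (D.guard i).IsSentence) :
    Definable (ι := Empty) fun _ M _ W => B.RunOn M W := by
  refine Definable.and ?_ (Definable.and ?_ ?_)
  · exact Definable.forallTuple ((definable_isFirst Sum.inr).imp
      ((B.definable_codes (N := fun _ M _ _ => M.toGraph) (fun _ _ _ _ => Finset.Subset.rfl)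
        ((Definable.const True).congr fun V M x W hx _ => by simp [hx])
        (fun r => Definable.rel r Sum.inr) Sum.inr).and (B.definable_ok hg Sum.inr)))
  · exact Definable.forallTuple ((B.definable_marked Sum.inr).imp (Definable.forallTuple
      ((B.definable_next (Sum.inl ∘ Sum.inr) Sum.inr).imp
        ((Definable.ord (Sum.inl ∘ Sum.inr) Sum.inr).and
          (B.definable_fits hg (Sum.inl ∘ Sum.inr) Sum.inr)))))
  · exact Definable.forallTuple ((B.definable_marked Sum.inr).imp
      ((definable_isFirst Sum.inr).or (Definable.existsTuple ((B.definable_marked Sum.inr).and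
        (B.definable_next Sum.inr (Sum.inl ∘ Sum.inr))))))

-- The product may range over all m-tuples, since an empty label contributes an empty product; the
-- contexts of the run need not be singled out.
open Classical in
theorem monoDefinable_weight :
    MonoDefinable (ι := Empty) fun _ M _ W => ∏ y ∈ M.tuples m, ∏ p : B.Step,
      ∏ a ∈ (B.labelAt M W y (Sum.inr p) : Finset (Fin (B.len p) → _)),
        B.term p _ (stateAt hm M W y) (Sum.elim y a) fun U => W U.shift := by
  have h1 (p : B.Step) := B.term_rel p ((Empty ⊕ Fin m) ⊕ Fin (B.len p)) (Sum.inl ∘ Sum.inr)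
    (Sum.map Sum.inr id)
  have h2 (p : B.Step) := Definable.mem_slice (ι := (Empty ⊕ Fin m) ⊕ Fin (B.len p)) (τ := τ) hm
    (Sum.inl ∘ Sum.inr) (B.num (Sum.inr p)) Sum.inr
  refine (MonoDefinable.bprod (Definable.const True)
    (MonoDefinable.prod fun p => MonoDefinable.bprod (h2 p) (h1 p))).congr fun V M x W _ _ => ?_
  rw [Finset.filter_true]
  refine Finset.prod_congr ?_ fun y _ => Finset.prod_congr rfl fun p _ =>
    Finset.prod_congr ?_ fun a _ => ?_
  · ext y
    rw [Graph.mem_tuples, mem_piFinset_const]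
  · refine Finset.ext fun (a : Fin (B.len p) → V) => ?_
    rw [mem_filter_of_decidable, mem_piFinset_const]
    exact ⟨fun h => ⟨mem_univ_of_mem_slice h, h⟩, fun h => h.2⟩
  · congr 1
    funext j
    rcases j with j | j <;> rfl

end Definability

end Steps

end SOL

/-! ### The sum over runs equals the valuation and is a long sum. -/

namespace SOL

universe u

variable {τ : Vocabulary} {m ℓ : ℕ} {R : Type u} [CommSemiring R]

theorem OrdGraph.ext' {V : Type} {N N' : OrdGraph τ m V} (h : N.toGraph = N'.toGraph)
    (hc : N.ctx = N'.ctx) (ho : ∀ s t, N.ord s t ↔ N'.ord s t) : N = N' := by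
  obtain ⟨G, c, o⟩ := N
  obtain ⟨G', c', o'⟩ := N'
  obtain rfl : G = G' := h
  obtain rfl : c = c' := hc
  obtain rfl : o = o' := funext fun s => funext fun t => propext (ho s t)
  rfl

theorem IsFirst.eq {V : Type} {A : Finset V} {O : (Fin m → V) → (Fin m → V) → Prop}
    (hO : IsLinear A O) {x y : Fin m → V} (hx : IsFirst A O x) (hy : IsFirst A O y) : x = y := by
  by_contra h
  exact hO.irrefl x (hO.trans _ _ _ (hx.2 y hy.1 (Ne.symm h)) (hy.2 x hx.1 h))

/-- `N` is a substructure of `M`, as far as its universe and ordering are concerned. -/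
structure OrdGraph.IsPart {V : Type} (N M : OrdGraph τ m V) : Prop where
  subset : N.univ ⊆ M.univ
  ord_iff : ∀ s t, N.ord s t ↔ (∀ j, s j ∈ N.univ ∧ t j ∈ N.univ) ∧ M.ord s t

namespace Steps

variable {hm : 0 < m} {D : RecDef τ m ℓ R} (B : Steps hm D) {V : Type}

/-! ### The sum over all runs is the valuation of the deconstruction tree -/

/-- The labels with relations on the universe of `M`. -/
abbrev Label (M : OrdGraph τ m V) : Type :=
  (q : B.Part) → {s : Finset (Fin (B.arity q) → V) // s ∈ (M.tuples (B.arity q)).powerset}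

variable {B}

/-- The relations of a label. -/
abbrev Label.raw {M : OrdGraph τ m V} (s : B.Label M) : B.RawLabel V := fun q => (s q).1

variable (B)

/-- Labels at contexts, as a system of labels. -/
def system (M : OrdGraph τ m V) (W : RelAssign V) :
    LabelSystem {y : Fin m → V // y ∈ M.tuples m} (B.Label M) where
  lt y y' := M.ord y.1 y'.1
  blank _ := ⟨∅, Finset.empty_mem_powerset _⟩
  next y s y' := B.Next M y.1 s.raw y'.1
  fits y s y' s' := B.Fits M W y.1 s.raw y'.1 s'.raw

/-- The weight of a label. -/
noncomputable def weight (M : OrdGraph τ m V) (W : RelAssign V)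
    (y : {y : Fin m → V // y ∈ M.tuples m}) (s : B.Label M) : R :=
  ∏ p : B.Step, ∏ a ∈ (s.raw (Sum.inr p) : Finset (Fin (B.len p) → V)),
    B.term p V (B.graphOf M y.1 s.raw) (Sum.elim y.1 a) W

open Classical in
/-- The sum of the weights of all runs in `M` from `N`. -/
noncomputable def runSumFrom (M : OrdGraph τ m V) (W : RelAssign V) (N : OrdGraph τ m V) : R :=
  (B.system M W).runSum (B.weight M W) (fun y => IsFirst N.univ N.ord y.1)
    fun y s => B.Codes N.toGraph s.raw ∧ B.Ok M W y.1 s.raw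

open Classical in
/-- The label at `N` for the step `p` with the tuple `a`. -/
noncomputable def label (N : OrdGraph τ m V) (p : B.Step) (a : Fin (B.len p) → V) : B.RawLabel V
  | .inl none => ({t ∈ N.tuples 1 | t 0 ∈ N.univ} : Finset (Fin 1 → V))
  | .inl (some r) => {t ∈ N.tuples (τ.arity r) | N.rel r t}
  | .inr p' => {a' ∈ N.tuples (B.len p') | (⟨p', a'⟩ : Σ p, Fin (B.len p) → V) = ⟨p, a⟩}

variable {B}

theorem codes_label (N : OrdGraph τ m V) (p : B.Step) (a : Fin (B.len p) → V) :
    B.Codes N.toGraph (B.label N p a) := by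
  classical
  refine ⟨fun t => ?_, fun r t => ?_⟩
  · refine mem_filter_of_decidable.trans ?_
    rw [Graph.mem_tuples, Fin.forall_fin_one, and_self]
  · refine mem_filter_of_decidable.trans ?_
    rw [Graph.mem_tuples]
    exact ⟨fun h => h.2, fun h => ⟨N.rel_mem r t h, h⟩⟩

theorem picks_label {N : OrdGraph τ m V} {p : B.Step} {a : Fin (B.len p) → V}
    (ha : ∀ j, a j ∈ N.univ) : B.Picks (B.label N p a) p a := by
  classical
  refine ⟨?_, fun p' a' h => ?_⟩
  · simp only [label, Finset.mem_filter, Graph.mem_tuples, and_true]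
    exact ha
  · simp only [label, Finset.mem_filter] at h
    exact h.2

theorem eq_label {N : OrdGraph τ m V} {s : B.RawLabel V} (hs : B.Codes N.toGraph s) {p : B.Step}
    {a : Fin (B.len p) → V} (ha : ∀ j, a j ∈ N.univ) (h : B.Picks s p a) : s = B.label N p a := by
  classical
  funext q
  rcases q with (_ | r) | p'
  · refine Finset.ext fun t => (hs.1 t).trans ((codes_label N p a).1 t).symm
  · refine Finset.ext fun t => (hs.2 r t).trans ((codes_label N p a).2 r t).symm
  · refine Finset.ext fun a' => ⟨fun h' => ?_, fun h' => ?_⟩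
    · obtain ⟨rfl, h2⟩ := Sigma.mk.inj_iff.1 (h.2 p' a' h')
      obtain rfl := eq_of_heq h2
      exact (picks_label ha).1
    · obtain ⟨rfl, h2⟩ := Sigma.mk.inj_iff.1 ((picks_label ha).2 p' a' h')
      obtain rfl := eq_of_heq h2
      exact h.1

/-- The label stores just the universe and the relations. The position supplies the context, and
`IsPart` recovers the ordering from that of `M`. -/
theorem graphOf_eq {M N : OrdGraph τ m V} (hN : N.IsPart M) {s : B.RawLabel V}
    (hs : B.Codes N.toGraph s) : B.graphOf M N.ctx s = N := by
  classical
  have hu : (B.graphOf M N.ctx s).univ = N.univ := by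
    ext a
    simp only [graphOf, coded, Finset.mem_filter]
    exact (and_congr_right fun _ => hs.1 fun _ => a).trans
      ⟨fun h => h.2, fun h => ⟨hN.subset h, h⟩⟩
  refine OrdGraph.ext' (Graph.ext hu ?_) rfl fun u v => ?_
  · funext r t
    have : (B.graphOf M N.ctx s).rel r t ↔
        (∀ j, t j ∈ (B.graphOf M N.ctx s).univ) ∧ t ∈ s (Sum.inl (some r)) := Iff.rfl
    rw [hu, hs.2] at this
    exact propext (this.trans ⟨fun h => h.2, fun h => ⟨N.rel_mem r t h, h⟩⟩)
  · have : (B.graphOf M N.ctx s).ord u v ↔ (∀ j, u j ∈ (B.graphOf M N.ctx s).univ ∧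
        v j ∈ (B.graphOf M N.ctx s).univ) ∧ M.ord u v := Iff.rfl
    rw [hu] at this
    exact this.trans (hN.ord_iff u v).symm

theorem prod_picks {s : B.RawLabel V} {p : B.Step} {a : Fin (B.len p) → V} (h : B.Picks s p a)
    (G : ∀ p, (Fin (B.len p) → V) → R) :
    ∏ p, ∏ a ∈ (s (Sum.inr p) : Finset (Fin (B.len p) → V)), G p a = G p a := by
  classical
  rw [Fintype.prod_eq_single p]
  · have : s (Sum.inr p) = {a} := Finset.eq_singleton_iff_unique_mem.2
      ⟨h.1, fun a' h' => by simpa using h.2 p a' h'⟩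
    rw [this, Finset.prod_singleton]
  · intro p' hp'
    have : s (Sum.inr p') = ∅ := Finset.eq_empty_of_forall_notMem fun a' h' =>
      hp' (congrArg Sigma.fst (h.2 p' a' h'))
    rw [this, Finset.prod_empty]

-- By `eq_label`, a label that codes `N` and picks a possible choice is determined by that choice,
-- so admissible labels and choices are in bijection.
open Classical in
theorem sum_labels {M N : OrdGraph τ m V} (hN : N.IsPart M) (W : RelAssign V)
    {_ : Fintype (B.Label M)}
    {_ : DecidablePred fun s : B.Label M => B.Codes N.toGraph s.raw ∧ B.Ok M W N.ctx s.raw}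
    (G : B.Label M → R)
    (G' : ∀ p : B.Step, (Fin (B.len p) → V) → R)
    (hG : ∀ (s : B.Label M) p a, B.Codes N.toGraph s.raw → B.Picks s.raw p a → B.Choice N W p a →
      G s = G' p a) :
    ∑ s : B.Label M with B.Codes N.toGraph s.raw ∧ B.Ok M W N.ctx s.raw, G s =
      ∑ p : B.Step, ∑ a ∈ (N.tuples (B.len p)) with B.Choice N W p a, G' p a := by
  have hlabel : ∀ p a q, B.label N p a q ∈ (M.tuples (B.arity q)).powerset := by
    intro p a q
    rw [Finset.mem_powerset]
    have h : ∀ k, N.tuples k ⊆ M.tuples k := fun k t ht =>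
      Graph.mem_tuples.2 fun j => hN.subset (Graph.mem_tuples.1 ht j)
    rcases q with (_ | r) | p' <;> exact (Finset.filter_subset _ _).trans (h _)
  rw [Finset.sum_sigma']
  symm
  refine Finset.sum_bij (fun x _ => (fun q => ⟨B.label N x.1 x.2 q, hlabel x.1 x.2 q⟩ : B.Label M))
    ?_ ?_ ?_ ?_
  · rintro ⟨p, a⟩ h
    simp only [Finset.mem_sigma, Finset.mem_univ, true_and, Finset.mem_filter] at h ⊢
    refine ⟨codes_label N p a, p, a, picks_label h.2.1, ?_⟩
    rw [graphOf_eq hN (codes_label N p a)]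
    exact h.2
  · rintro ⟨p, a⟩ h ⟨p', a'⟩ h' heq
    simp only [Finset.mem_sigma, Finset.mem_univ, true_and, Finset.mem_filter] at h h'
    have heq' : B.label N p a = B.label N p' a' :=
      funext fun q => congrArg Subtype.val (congrFun heq q)
    have := (picks_label (N := N) (p := p) h.2.1).1
    rw [heq'] at this
    exact (picks_label h'.2.1).2 _ _ this
  · intro s hs
    obtain ⟨hc, p, a, hp, hch⟩ := (Finset.mem_filter.1 hs).2
    rw [graphOf_eq hN hc] at hch
    refine ⟨⟨p, a⟩, ?_, ?_⟩
    · simp only [Finset.mem_sigma, Finset.mem_univ, true_and, Finset.mem_filter]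
      exact ⟨Graph.mem_tuples.2 hch.1, hch⟩
    · funext q
      exact Subtype.ext (congrFun (eq_label hc hch.1 hp) q).symm
  · rintro ⟨p, a⟩ h
    simp only [Finset.mem_sigma, Finset.mem_univ, true_and, Finset.mem_filter] at h
    exact (hG _ p a (codes_label N p a) (picks_label h.2.1) h.2).symm

theorem isStrictOrder_system {M : OrdGraph τ m V} (hM : IsLinear M.univ M.ord) (W : RelAssign V) :
    IsStrictOrder _ (B.system M W).lt where
  irrefl y := hM.irrefl y.1
  trans _ _ _ h h' := hM.trans _ _ _ h h'

theorem weight_blank (M : OrdGraph τ m V) (W : RelAssign V)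
    (y : {y : Fin m → V // y ∈ M.tuples m}) : B.weight M W y (B.system M W).blank = 1 := by
  simp [weight, system, Label.raw]

open Classical in
theorem runSumFrom_of_empty {M N : OrdGraph τ m V} (hM : IsLinear M.univ M.ord) (W : RelAssign V)
    (hN : N.univ = ∅) : B.runSumFrom M W N = 1 := by
  have := isStrictOrder_system (B := B) hM W
  refine LabelSystem.runSum_of_isEmpty (weight_blank M W) _ fun y hy => ?_
  -- As m > 0, a first tuple would have a component in the empty universe.
  have := hy.1 ⟨0, hm⟩
  simp [hN] at this

-- The recursion of the valuation, with each coefficient expanded into its choices. By linearity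
-- `N.ctx` is the only start; `deletes` makes the contexts increase, as `LabelSystem.runSum_eq_sum`
-- requires.
open Classical in
theorem runSumFrom_eq_sum {K : GraphClass τ} (hD : D.Feasible K) {M N : OrdGraph τ m V}
    (hM : IsLinear M.univ M.ord) (W : RelAssign V) (hN : D.IsValord K N) (hNM : N.IsPart M) :
    B.runSumFrom M W N = ∑ p : B.Step, ∑ a ∈ (N.tuples (B.len p)) with B.Choice N W p a,
      B.term p V N (Sum.elim N.ctx a) W * B.runSumFrom M W ((D.scheme p.1).star N) := by
  have := isStrictOrder_system (B := B) hM W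
  let y : {y : Fin m → V // y ∈ M.tuples m} :=
    ⟨N.ctx, Graph.mem_tuples.2 fun j => hNM.subset (hN.first.1 j)⟩
  -- The label picks a single step, so the step asserted to exist in `Next` is `p`.
  have hnext : ∀ (s : B.Label M) p a, B.Codes N.toGraph s.raw → B.Picks s.raw p a →
      ∀ y', B.Next M N.ctx s.raw y' ↔
        IsFirst ((D.scheme p.1).star N).univ ((D.scheme p.1).star N).ord y' := by
    intro s p a hc hp y'
    rw [Next, graphOf_eq hNM hc]
    refine ⟨fun ⟨p', ⟨a', ha'⟩, h⟩ => ?_, fun h => ⟨p, ⟨a, hp.1⟩, h⟩⟩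
    obtain rfl : p' = p := congrArg Sigma.fst (hp.2 p' a' ha')
    exact h
  rw [runSumFrom, LabelSystem.runSum_eq_sum (weight_blank M W) (y := y)]
  · refine sum_labels hNM W _ (fun p a => B.term p V N (Sum.elim N.ctx a) W *
      B.runSumFrom M W ((D.scheme p.1).star N)) fun s p a hc hp hch => ?_
    have hw : B.weight M W y s = B.term p V N (Sum.elim N.ctx a) W := by
      rw [weight, prod_picks hp, graphOf_eq hNM hc]
    rw [hw, runSumFrom]
    congr 2
    · funext y'
      exact propext (hnext s p a hc hp y'.1)
    · funext y' s'
      refine propext (and_congr_left fun _ => ?_)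
      simp only [y, graphOf_eq hNM hc]
      refine ⟨fun ⟨p', ⟨a', ha'⟩, h⟩ => ?_, fun h => ⟨p, ⟨a, hp.1⟩, h⟩⟩
      obtain rfl : p' = p := congrArg Sigma.fst (hp.2 p' a' ha')
      exact h
  · intro x
    exact ⟨fun h => Subtype.ext (h.eq hN.linear hN.first), fun h => by rw [h]; exact hN.first⟩
  · rintro s ⟨hc, p, a, hp, hch⟩
    refine ⟨fun hs => ?_, fun y' hy' => ?_⟩
    -- A picked tuple makes the label nonempty, even if the tuple has length 0.
    · have := hp.1
      rw [hs] at this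
      exact absurd this (Finset.notMem_empty a)
    · have hy' := (hnext s p a hc hp y'.1).1 hy'
      rw [graphOf_eq hNM hc] at hch
      have hsub := (D.scheme p.1).star_univ_subset N
      -- The old context has a component that is now deleted, so it differs from the new first
      -- tuple; being first in `N`, it precedes it.
      obtain ⟨j, hj⟩ := (hD.decon p.1).deletes V N hN hch.2.1
      have hne : y'.1 ≠ N.ctx := fun h => hj (by rw [← h]; exact hy'.1 j)
      exact ((hNM.ord_iff _ _).1 (hN.first.2 _ (fun j => hsub (hy'.1 j)) hne)).2

theorem isPart_star {K : GraphClass τ} (hD : D.Feasible K) {M N : OrdGraph τ m V}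
    (hN : D.IsValord K N) (hNM : N.IsPart M) {i : Fin ℓ} (hi : N.Models (D.guard i)) :
    ((D.scheme i).star N).IsPart M where
  subset := ((D.scheme i).star_univ_subset N).trans hNM.subset
  ord_iff s t := by
    have hsub := (D.scheme i).star_univ_subset N
    refine ⟨fun h => ⟨h.1, ?_⟩, fun ⟨h, h'⟩ => ?_⟩
    · have := ((hD.decon i).restricts V N hN hi s t (fun j => (h.1 j).1) fun j => (h.1 j).2).1 h
      exact ((hNM.ord_iff s t).1 this).2
    · refine ((hD.decon i).restricts V N hN hi s t (fun j => (h j).1) fun j => (h j).2).2 ?_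
      exact (hNM.ord_iff s t).2 ⟨fun j => ⟨hsub (h j).1, hsub (h j).2⟩, h'⟩

/-- Induction on the tree. `M` stays fixed, as all labels live on it, while `N` descends; `IsPart`
is the invariant. `W` is arbitrary because the coefficients are closed. -/
theorem runSumFrom_eq_value {K : GraphClass τ} (hD : D.Feasible K) {M : OrdGraph τ m V}
    (hM : IsLinear M.univ M.ord) (W : RelAssign V) {N : OrdGraph τ m V} (Γ : DeconTree D N)
    (hN : N.univ.Nonempty → D.IsValord K N) (hNM : N.IsPart M) :
    B.runSumFrom M W N = Γ.value := by
  classical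
  induction Γ with
  | leaf N h => exact runSumFrom_of_empty hM W h
  | node N h he child ih =>
    have hN := hN h
    rw [runSumFrom_eq_sum hD hM W hN hNM, Fintype.sum_sigma, DeconTree.value]
    refine Finset.sum_congr rfl fun i _ => ?_
    by_cases hi : N.Models (D.guard i)
    · rw [dif_pos hi, ← ih i hi ((hD.decon i).valord V N hN hi) (isPart_star hD hN hNM hi),
        B.coeff_eval i V N _ W, Finset.sum_mul]
      refine Finset.sum_congr rfl fun k _ => ?_
      rw [Finset.sum_mul]
      refine Finset.sum_congr (Finset.filter_congr fun a ha => ?_) fun _ _ => rfl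
      simp only [Choice, hi, true_and, and_iff_right_iff_imp]
      exact fun _ => Graph.mem_tuples.1 ha
    -- `Choice` includes the guard, so a disabled index has no choices.
    · rw [dif_neg hi]
      refine Finset.sum_eq_zero fun k _ => Finset.sum_eq_zero fun a ha => ?_
      exact (hi (Finset.mem_filter.1 ha).2.2.1).elim

/-! ### The sum over all runs as a long sum -/

variable (B)

open Classical in
/-- The relation variables that describe a run. -/
noncomputable def vars : Finset RelVar := Finset.univ.image B.var

theorem var_mem_vars (q : B.Part) : B.var q ∈ B.vars := by
  classical exact Finset.mem_image_of_mem _ (Finset.mem_univ q)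

/-- The long sum binds reserved variables only, so the relations passed to `cond` and `term` remain
those of `z`. -/
theorem overRel_shift (z : Assign V) (f : (U : B.vars) → Finset (Fin U.1.arity → V)) :
    (fun U => (z.overRel B.vars f).rel (RelVar.shift U)) = fun U => z.rel (RelVar.shift U) := by
  classical
  funext U
  have : U.shift ∉ B.vars := fun h => by
    obtain ⟨q, -, hq⟩ := Finset.mem_image.1 h
    exact auxVar_ne_shift hm _ _ U hq
  exact dif_neg this

/-- The labelling described by relations. -/
noncomputable def labelling (M : OrdGraph τ m V) (W : RelAssign V)
    (y : {y : Fin m → V // y ∈ M.tuples m}) : B.Label M := fun q =>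
  ⟨B.labelAt M W y.1 q, Finset.mem_powerset.2 fun _ h =>
    Graph.mem_tuples.2 (mem_univ_of_mem_slice h)⟩

theorem ne_blank_iff {M : OrdGraph τ m V} {W : RelAssign V} {s : B.Label M} :
    s ≠ (B.system M W).blank ↔ B.Marked s.raw := by
  rw [← not_iff_not, not_ne_iff, Marked, not_exists]
  refine ⟨fun h q => by rw [h]; simp [system, Label.raw], fun h => funext fun q => Subtype.ext ?_⟩
  exact Finset.eq_empty_of_forall_notMem (not_exists.1 (h q))

theorem runOn_iff (M : OrdGraph τ m V) (W : RelAssign V) : B.RunOn M W ↔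
    (B.system M fun U => W U.shift).IsRun (fun y => IsFirst M.univ M.ord y.1)
      (fun y s => B.Codes M.toGraph s.raw ∧ B.Ok M (fun U => W U.shift) y.1 s.raw)
      (B.labelling M W) := by
  constructor
  · rintro ⟨h1, h2, h3⟩
    refine ⟨fun y hy => h1 y.1 (Graph.mem_tuples.1 y.2) hy, fun y hy y' hn => ?_, fun y hy => ?_⟩
    · exact h2 y.1 (Graph.mem_tuples.1 y.2) (B.ne_blank_iff.1 hy) y'.1 (Graph.mem_tuples.1 y'.2) hn
    · refine (h3 y.1 (Graph.mem_tuples.1 y.2) (B.ne_blank_iff.1 hy)).imp_right ?_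
      exact fun ⟨y₀, h0, h1, h2⟩ => ⟨⟨y₀, Graph.mem_tuples.2 h0⟩, B.ne_blank_iff.2 h1, h2⟩
  · rintro ⟨h1, h2, h3⟩
    refine ⟨fun y hy h => h1 ⟨y, Graph.mem_tuples.2 hy⟩ h, fun y hy hy' y' hy'' hn => ?_,
      fun y hy hy' => ?_⟩
    · exact h2 ⟨y, Graph.mem_tuples.2 hy⟩ (B.ne_blank_iff.2 hy') ⟨y', Graph.mem_tuples.2 hy''⟩ hn
    · refine (h3 ⟨y, Graph.mem_tuples.2 hy⟩ (B.ne_blank_iff.2 hy')).imp_right ?_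
      exact fun ⟨y₀, h1, h2⟩ => ⟨y₀.1, Graph.mem_tuples.1 y₀.2, B.ne_blank_iff.1 h1, h2⟩

theorem overRel_var (z : Assign V) (f : (U : B.vars) → Finset (Fin U.1.arity → V)) (q : B.Part) :
    (z.overRel B.vars f).rel (B.var q) = f ⟨B.var q, B.var_mem_vars q⟩ :=
  dif_pos (B.var_mem_vars q)

theorem mem_labelling {M : OrdGraph τ m V} {z : Assign V}
    {f : (U : B.vars) → Finset (Fin U.1.arity → V)} {q : B.Part}
    {y : {y : Fin m → V // y ∈ M.tuples m}} {t : Fin (B.arity q) → V} :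
    t ∈ (B.labelling M (z.overRel B.vars f).rel y q).1 ↔
      t ∈ M.tuples (B.arity q) ∧ Fin.append y.1 t ∈ f ⟨B.var q, B.var_mem_vars q⟩ := by
  classical
  rw [← B.overRel_var z f q]
  exact mem_filter_of_decidable

theorem append_mem_tuples {M : OrdGraph τ m V} {k : ℕ} {y : Fin m → V} {t : Fin k → V} :
    Fin.append y t ∈ M.tuples (m + k) ↔ y ∈ M.tuples m ∧ t ∈ M.tuples k := by
  simp only [Graph.mem_tuples]
  refine ⟨fun h => ⟨fun j => by simpa using h (Fin.castAdd k j),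
    fun j => by simpa using h (Fin.natAdd m j)⟩, fun h j => ?_⟩
  refine Fin.addCases (fun i => ?_) (fun i => ?_) j
  · rw [Fin.append_left]; exact h.1 i
  · rw [Fin.append_right]; exact h.2 i

theorem forall_append {k : ℕ} {p : (Fin (m + k) → V) → Prop} :
    (∀ w, p w) ↔ ∀ y t, p (Fin.append y t) :=
  ⟨fun h _ _ => h _, fun h w => by rw [← Fin.append_castAdd_natAdd (f := w)]; exact h _ _⟩

open Classical in
/-- Interpretations of the reserved relation variables correspond to labellings. -/
theorem sum_overRel (M : OrdGraph τ m V) (z : Assign V)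
    {_ : Fintype ({y : Fin m → V // y ∈ M.tuples m} → B.Label M)}
    (G : ({y : Fin m → V // y ∈ M.tuples m} → B.Label M) → R) :
    ∑ f ∈ Fintype.piFinset fun U : B.vars => (M.tuples U.1.arity).powerset,
      G (B.labelling M (z.overRel B.vars f).rel) = ∑ g, G g := by
  refine Finset.sum_bij (fun f _ => B.labelling M (z.overRel B.vars f).rel)
    (fun _ _ => Finset.mem_univ _) ?_ ?_ (fun _ _ => rfl)
  · intro f hf f' hf' h
    funext ⟨U, hU⟩
    obtain ⟨q, -, rfl⟩ := Finset.mem_image.1 hU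
    have hf := Finset.mem_powerset.1 (Fintype.mem_piFinset.1 hf ⟨B.var q, hU⟩)
    have hf' := Finset.mem_powerset.1 (Fintype.mem_piFinset.1 hf' ⟨B.var q, hU⟩)
    refine Finset.ext (forall_append.2 fun y t => ?_)
    by_cases hy : y ∈ M.tuples m
    · by_cases ht : t ∈ M.tuples (B.arity q)
      · have h1 := B.mem_labelling (M := M) (z := z) (f := f) (q := q) (y := ⟨y, hy⟩) (t := t)
        have h2 := B.mem_labelling (M := M) (z := z) (f := f') (q := q) (y := ⟨y, hy⟩) (t := t)
        rw [show B.labelling M (z.overRel B.vars f).rel = _ from h] at h1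
        simpa only [ht, true_and] using h1.symm.trans h2
      · exact iff_of_false (fun h => ht (append_mem_tuples.1 (hf h)).2)
          fun h => ht (append_mem_tuples.1 (hf' h)).2
    · exact iff_of_false (fun h => hy (append_mem_tuples.1 (hf h)).1)
        fun h => hy (append_mem_tuples.1 (hf' h)).1
  · intro g _
    let e : B.Part ≃ B.vars := Equiv.ofBijective (fun q => ⟨B.var q, B.var_mem_vars q⟩)
      ⟨fun q q' h => B.var_injective (congrArg Subtype.val h), fun ⟨U, hU⟩ => by
        obtain ⟨q, -, rfl⟩ := Finset.mem_image.1 hU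
        exact ⟨q, rfl⟩⟩
    -- The relation for `q` consists of the tuples y followed by t with t in part `q` of the label
    -- at y.
    let h (q : B.Part) : Finset (Fin (m + B.arity q) → V) :=
      {w ∈ M.tuples (m + B.arity q) | ∃ hy : (fun j => w (Fin.castAdd _ j)) ∈ M.tuples m,
        (fun j => w (Fin.natAdd m j)) ∈ (g ⟨_, hy⟩ q).1}
    let f := Equiv.piCongrLeft (fun U : B.vars => Finset (Fin U.1.arity → V)) e h
    have hf (q : B.Part) : f ⟨B.var q, B.var_mem_vars q⟩ = h q :=
      Equiv.piCongrLeft_apply_apply (fun U : B.vars => Finset (Fin U.1.arity → V)) e h q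
    refine ⟨f, Fintype.mem_piFinset.2 fun ⟨U, hU⟩ => ?_, ?_⟩
    · obtain ⟨q, -, rfl⟩ := Finset.mem_image.1 hU
      rw [hf, Finset.mem_powerset]
      exact Finset.filter_subset _ _
    · funext y q
      refine Subtype.ext (Finset.ext fun t => ?_)
      rw [B.mem_labelling, hf]
      simp only [h, Finset.mem_filter, append_mem_tuples, Fin.append_left, Fin.append_right]
      refine ⟨fun ⟨_, _, _, h⟩ => h, fun ht => ?_⟩
      have := Finset.mem_powerset.1 (g y q).2 ht
      exact ⟨this, ⟨y.2, this⟩, y.2, ht⟩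

-- The expression is one long sum over `vars`, with `RunOn` as condition and the weight as summand.
-- The dependence on `z` is harmless, as `runSumFrom_eq_value` holds for every `W`.
open Classical in
theorem exists_polyExpr (hg : ∀ i, (D.guard i).IsSentence) : ∃ S : PolyExpr τ m R,
    ∀ (V : Type) (M : OrdGraph τ m V), ∀ z ∈ M.Ass,
      S.eval M z = B.runSumFrom M (fun U => z.rel U.shift) M := by
  obtain ⟨φ, hφ⟩ := B.definable_runOn hg Empty.elim
  obtain ⟨t, ht⟩ := B.monoDefinable_weight Empty.elim
  refine ⟨.lsum B.vars φ (.mono t), fun V M z hz => ?_⟩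
  rw [runSumFrom, LabelSystem.runSum, Finset.sum_filter, ← B.sum_overRel M z, PolyExpr.eval,
    Finset.sum_filter]
  refine Finset.sum_congr rfl fun f hf => ?_
  have hz' : z.overRel B.vars f ∈ M.Ass := Graph.Ass.overRel hz _ fun U =>
    Finset.mem_powerset.1 (Fintype.mem_piFinset.1 hf U)
  refine if_congr ?_ ?_ rfl
  · refine (hφ V M _ hz').trans ((B.runOn_iff M _).trans ?_)
    rw [overRel_shift]
  · rw [PolyExpr.eval, ht V M _ hz']
    beta_reduce
    rw [overRel_shift]
    exact (Finset.prod_coe_sort (M.tuples m) fun y => ∏ p : B.Step,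
      ∏ a ∈ (B.labelAt M (z.overRel B.vars f).rel y (Sum.inr p) : Finset (Fin (B.len p) → V)),
        B.term p _ (stateAt hm M (z.overRel B.vars f).rel y) (Sum.elim y a)
          fun U => z.rel U.shift).symm

end Steps

end SOL

theorem theorem5p1 {R : Type*} [CommSemiring R] (τ : SOL.Vocabulary) (m ℓ : ℕ)
    (K : SOL.GraphClass τ) (D : SOL.RecDef τ m ℓ R) (hD : D.Feasible K) :
    ∃ S : SOL.PolyExpr τ m R, ∀ (V : Type) (G : SOL.OrdGraph τ m V), D.IsValord K G →
      ∀ (Γ : SOL.DeconTree D G), ∀ z ∈ G.Ass, Γ.value = S.eval G z := by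
  rcases Nat.eq_zero_or_pos m with rfl | hm
  -- For m = 0 there is no context component to delete, so a tree could only be a leaf; but an empty
  -- universe admits no assignment. Any expression will do.
  · refine ⟨.mono (.const 0), fun V G hG Γ z hz => ?_⟩
    cases Γ with
    | leaf _ h => exact absurd (hz.1 0) (by simp [h])
    | node _ h he child =>
      obtain ⟨i, hi⟩ := he
      obtain ⟨j, -⟩ := (hD.decon i).deletes V G hG hi
      exact j.elim0
  · obtain ⟨B⟩ := SOL.nonempty_steps hm hD.coeff_short hD.coeff_closed
    obtain ⟨S, hS⟩ := B.exists_polyExpr fun i => (hD.decon i).guard_sentence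
    refine ⟨S, fun V G hG Γ z hz => ?_⟩
    rw [hS V G z hz]
    refine (SOL.Steps.runSumFrom_eq_value hD hG.linear _ Γ (fun _ => hG)
      ⟨Finset.Subset.rfl, fun s t => ?_⟩).symm
    exact ⟨fun h => ⟨hG.linear.mem s t h, h⟩, fun h => h.2⟩
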